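/- Let $X$ be a locally compact Hausdorff space and let $U\subseteq X$ be an open subset. Identify $C_0(U)$ with the ideal of those functions in $C_0(X)$ that vanish outside $U$, and let $\ell_2(U)=\ell_2(C_0(U))$ be the Hilbert module of sequences $(x_i)_{i\ge 0}$ in $C_0(U)$ such that $\sum_i x_i^*x_i$ converges in norm, with $\langle x,y\rangle=\sum_i x_i^*y_i$. For a Hilbert $C_0(X)$-module $M$ write $M|_U:=\overline{MC_0(U)}$ (closed linear span) and $M|_{X\setminus U}:=M/M|_U$; the latter is a Hilbert module over $C_0(X\setminus U)\cong C_0(X)/C_0(U)$, the inner product of two classes being the restriction to $X\setminus U$ of the inner product of representatives. An isomorphism of Hilbert modules is a bijective module map that preserves the inner products. A Hilbert $C_0(X)$-module $M$ is countably generated if it contains a countable set $\{m_i\}$ such that the finite sums $\sum_i m_i\lambda_i$, $\lambda_i\in C_0(X)$, are dense in $M$. Let $M$ and $N$ be countably generated Hilbert $C_0(X)$-modules with $M|_U\cong N|_U\cong \ell_2(U)$, and let $\phi\colon M|_{X\setminus U}\to N|_{X\setminus U}$ be an isomorphism of Hilbert modules. Then there is an isomorphism of Hilbert modules $\psi\colon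 M\to N$ such that $\psi|_{X\setminus U}=\phi$, that is, the class of $\psi(m)$ in $N|_{X\setminus U}$ is $\phi$ of the class of $m$ in $M|_{X\setminus U}$, for every $m\in M$. -/

import Mathlib

open scoped ZeroAtInfty InnerProductSpace
open Filter Topology TopologicalSpace

noncomputable section

set_option linter.unusedSectionVars false

namespace HilbertC0

/-! ### The C⋆-algebra of continuous functions vanishing at infinity, with its order -/

section Order

variable {X : Type*} [TopologicalSpace X]

open scoped ComplexOrder in
/-- The usual (pointwise) order of the C⋆-algebra `C₀(X, ℂ)`: `f ≤ g` iff `g x - f x` is a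
nonnegative real number for all `x`. -/
instance instPartialOrder : PartialOrder C₀(X, ℂ) :=
  PartialOrder.lift (fun f => (f : X → ℂ)) DFunLike.coe_injective

open scoped ComplexOrder in
theorem le_iff {f g : C₀(X, ℂ)} : f ≤ g ↔ ∀ x, f x ≤ g x := Iff.rfl

open scoped ComplexOrder in
theorem nonneg_iff {f : C₀(X, ℂ)} : 0 ≤ f ↔ ∀ x, 0 ≤ f x := Iff.rfl

open scoped ComplexOrder in
/-- The pointwise order is the order of the C⋆-algebra: positive elements are the `s⋆ s`. -/
instance instStarOrderedRing : StarOrderedRing C₀(X, ℂ) := by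
  refine StarOrderedRing.of_le_iff fun f g => ⟨fun h => ?_, ?_⟩
  · have hc : Continuous fun x => ((√((g x - f x).re) : ℝ) : ℂ) :=
      Complex.continuous_ofReal.comp (Real.continuous_sqrt.comp (Complex.continuous_re.comp
        ((map_continuous g).sub (map_continuous f))))
    have h0 : Tendsto (fun x => ((√((g x - f x).re) : ℝ) : ℂ)) (cocompact X) (𝓝 0) := by
      have h1 : Tendsto (fun x => g x - f x) (cocompact X) (𝓝 0) := zero_at_infty (g - f)
      have h2 : Continuous fun z : ℂ => ((√z.re : ℝ) : ℂ) := by fun_prop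
      have h3 := (h2.tendsto 0).comp h1
      simp only [Complex.zero_re, Real.sqrt_zero, Complex.ofReal_zero] at h3
      exact h3
    refine ⟨⟨⟨_, hc⟩, h0⟩, ?_⟩
    ext x
    have hx : 0 ≤ g x - f x := sub_nonneg.2 (h x)
    obtain ⟨hr, hi⟩ := Complex.nonneg_iff.1 hx
    have e : ((g x - f x).re : ℂ) = g x - f x := by
      apply Complex.ext
      · simp
      · simpa using hi
    have : star (((√((g x - f x).re) : ℝ) : ℂ)) * ((√((g x - f x).re) : ℝ) : ℂ) = g x - f x := by
      rw [Complex.star_def, Complex.conj_ofReal, ← Complex.ofReal_mul, Real.mul_self_sqrt hr, e]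
    change g x = f x + star (((√((g x - f x).re) : ℝ) : ℂ)) * ((√((g x - f x).re) : ℝ) : ℂ)
    rw [this]
    ring
  · rintro ⟨s, rfl⟩ x
    exact le_add_of_nonneg_right (star_mul_self_nonneg (s x))

theorem norm_apply_le (f : C₀(X, ℂ)) (x : X) : ‖f x‖ ≤ ‖f‖ :=
  f.toBCF.norm_coe_le_norm x

theorem norm_le_of {f : C₀(X, ℂ)} {C : ℝ} (hC : 0 ≤ C) (h : ∀ x, ‖f x‖ ≤ C) : ‖f‖ ≤ C :=
  (BoundedContinuousFunction.norm_le hC (f := f.toBCF)).2 h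

/-- Evaluation at a point, as a continuous additive map. -/
def evalHom (x : X) : C₀(X, ℂ) →+ ℂ where
  toFun f := f x
  map_zero' := rfl
  map_add' _ _ := rfl

theorem continuous_evalHom (x : X) : Continuous (evalHom x : C₀(X, ℂ) → ℂ) :=
  AddMonoidHomClass.continuous_of_bound (evalHom x) 1 fun f => by
    rw [one_mul]
    exact norm_apply_le f x

end Order

/-! ### Generalities on Hilbert modules -/

section General

variable {A E F : Type*} [NonUnitalCStarAlgebra A] [PartialOrder A]
variable [AddCommGroup E] [Module ℂ E] [SMul A E] [Norm E] [CStarModule A E]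
variable [AddCommGroup F] [Module ℂ F] [SMul A F] [Norm F] [CStarModule A F]

variable (A E F) in
/-- An isomorphism of Hilbert `A`-modules: a bijective `A`-linear map that preserves the
`A`-valued inner product. -/
structure Iso extends E ≃ₗ[ℂ] F where
  map_act' : ∀ (a : A) (m : E), toFun (a • m) = a • toFun m
  map_inner' : ∀ m n : E, ⟪toFun m, toFun n⟫_A = ⟪m, n⟫_A

instance : CoeFun (Iso A E F) fun _ => E → F := ⟨fun f => f.toLinearEquiv⟩

variable (A E) in
/-- A Hilbert `A`-module `E` is countably generated if it contains a countable set `s` such that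
the finite sums of elements `a • m` with `a ∈ A`, `m ∈ s` are dense in `E`. -/
def CountablyGenerated [TopologicalSpace E] : Prop :=
  ∃ s : Set E, s.Countable ∧
    Dense (Submodule.span ℂ {n : E | ∃ a : A, ∃ m ∈ s, n = a • m} : Set E)

theorem ext_inner {x y : E} (h : ∀ z : E, ⟪z, x⟫_A = ⟪z, y⟫_A) : x = y := by
  have : ⟪x - y, x - y⟫_A = 0 := by
    rw [CStarModule.inner_sub_right, h, sub_self]
  exact sub_eq_zero.1 (CStarModule.inner_self.1 this)

theorem act_add (a : A) (x y : E) : a • (x + y) = a • x + a • y :=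
  ext_inner (A := A) fun z => by simp [mul_add]

theorem act_smul (a : A) (c : ℂ) (x : E) : a • (c • x) = c • (a • x) :=
  ext_inner (A := A) fun z => by simp [mul_smul_comm]

theorem add_act (a b : A) (x : E) : (a + b) • x = a • x + b • x :=
  ext_inner (A := A) fun z => by simp [add_mul]

theorem sub_act (a b : A) (x : E) : (a - b) • x = a • x - b • x :=
  ext_inner (A := A) fun z => by simp [sub_mul]

theorem mul_act (a b : A) (x : E) : (a * b) • x = a • (b • x) :=
  ext_inner (A := A) fun z => by simp [mul_assoc]

/-- The action of `a : A` on a Hilbert module, as a linear map. -/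
def actₗ (a : A) : E →ₗ[ℂ] E where
  toFun x := a • x
  map_add' := act_add a
  map_smul' c x := act_smul a c x

theorem norm_act_le (a : A) (x : E) : ‖a • x‖ ≤ ‖a‖ * ‖x‖ := by
  have h : ‖a • x‖ ^ 2 ≤ (‖a‖ * ‖x‖) ^ 2 := by
    rw [CStarModule.norm_sq_eq A, mul_pow, CStarModule.norm_sq_eq A (x := x)]
    simp only [CStarModule.inner_op_smul_right, CStarModule.inner_op_smul_left]
    calc ‖a * (⟪x, x⟫_A * star a)‖ ≤ ‖a‖ * (‖⟪x, x⟫_A‖ * ‖star a‖) :=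
          (norm_mul_le _ _).trans (by gcongr; exact norm_mul_le _ _)
      _ = ‖a‖ ^ 2 * ‖⟪x, x⟫_A‖ := by rw [norm_star]; ring
  exact (pow_le_pow_iff_left₀ (CStarModule.norm_nonneg A)
    (mul_nonneg (norm_nonneg _) (CStarModule.norm_nonneg A)) two_ne_zero).1 h

end General

theorem continuous_act {A E : Type*} [NonUnitalCStarAlgebra A] [PartialOrder A]
    [NormedAddCommGroup E] [NormedSpace ℂ E] [SMul A E] [CStarModule A E] (a : A) :
    Continuous fun x : E => a • x :=
  AddMonoidHomClass.continuous_of_bound (actₗ a : E →ₗ[ℂ] E) ‖a‖ (norm_act_le a)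

/-! ### The ideal `C₀(U)` and the restriction of a module to an open set -/

section Open

variable {X : Type*} [TopologicalSpace X]

/-- `C₀(U)` for an open set `U`, regarded as an ideal of `C₀(X)` in the usual way: it consists of
the functions in `C₀(X)` that vanish outside `U`. -/
def openIdeal (U : Opens X) : Submodule ℂ C₀(X, ℂ) where
  carrier := {a | ∀ x ∉ U, a x = 0}
  zero_mem' _ _ := rfl
  add_mem' ha hb x hx := by simp [ha x hx, hb x hx]
  smul_mem' c a ha x hx := by simp [ha x hx]

variable (M : Type*) [NormedAddCommGroup M] [NormedSpace ℂ M] [SMul C₀(X, ℂ) M]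
  [CStarModule C₀(X, ℂ) M]

/-- The restriction `M|_U := M C₀(U)` of a Hilbert `C₀(X)`-module to an open set `U`, i.e. the
closed linear span of the `a • m` with `a ∈ C₀(U)`, `m ∈ M`. -/
def openPart (U : Opens X) : Submodule ℂ M :=
  (Submodule.span ℂ {n : M | ∃ a ∈ openIdeal U, ∃ m : M, n = a • m}).topologicalClosure

variable {M}

instance isClosed_openPart (U : Opens X) : IsClosed (openPart M U : Set M) :=
  Submodule.isClosed_topologicalClosure _

theorem act_mem_openPart {U : Opens X} {a : C₀(X, ℂ)} (ha : a ∈ openIdeal U) (m : M) :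
    a • m ∈ openPart M U :=
  Submodule.le_topologicalClosure _ (Submodule.subset_span ⟨a, ha, m, rfl⟩)

theorem act_mem_of_mem {U : Opens X} (b : C₀(X, ℂ)) {n : M} (hn : n ∈ openPart M U) :
    b • n ∈ openPart M U := by
  have hcl : IsClosed {n : M | b • n ∈ openPart M U} :=
    (isClosed_openPart U).preimage (continuous_act b)
  refine closure_minimal (fun n hn => ?_) hcl hn
  have hle : Submodule.span ℂ {n : M | ∃ a ∈ openIdeal U, ∃ m : M, n = a • m} ≤
      (openPart M U).comap (actₗ b) := by
    refine Submodule.span_le.2 ?_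
    rintro _ ⟨a, ha, m, rfl⟩
    change b • a • m ∈ openPart M U
    rw [← mul_act]
    exact act_mem_openPart (fun x hx => by simp [ha x hx]) m
  exact hle hn

theorem inner_apply_eq_zero {U : Opens X} (m : M) {n : M} (hn : n ∈ openPart M U) {x : X}
    (hx : x ∉ U) : (⟪m, n⟫_(C₀(X, ℂ))) x = 0 := by
  have hcont : Continuous fun n : M => (⟪m, n⟫_(C₀(X, ℂ))) x :=
    (continuous_evalHom x).comp (CStarModule.innerSL (A := C₀(X, ℂ)) m).continuous
  have hcl : IsClosed {n : M | (⟪m, n⟫_(C₀(X, ℂ))) x = 0} := isClosed_eq hcont continuous_const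
  refine closure_minimal (fun n hn => ?_) hcl hn
  induction hn using Submodule.span_induction with
  | mem n hn =>
    obtain ⟨a, ha, m', rfl⟩ := hn
    simp [ha x hx]
  | zero => simp
  | add y z _ _ hy hz =>
    simp only [Set.mem_ofPred_eq] at hy hz ⊢
    simp [hy, hz]
  | smul c y _ hy =>
    simp only [Set.mem_ofPred_eq] at hy ⊢
    simp [hy]

instance openPart.instSMul (U : Opens X) : SMul C₀(X, ℂ) (openPart M U) :=
  ⟨fun a n => ⟨a • (n : M), act_mem_of_mem a n.2⟩⟩

/-- `M|_U` is a Hilbert module with the operations inherited from `M`; its inner product takes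
values in `C₀(U) ⊆ C₀(X)`. -/
instance openPart.instCStarModule (U : Opens X) : CStarModule C₀(X, ℂ) (openPart M U) where
  inner m n := ⟪(m : M), (n : M)⟫_(C₀(X, ℂ))
  inner_add_right := CStarModule.inner_add_right
  inner_self_nonneg := CStarModule.inner_self_nonneg
  inner_self := CStarModule.inner_self.trans Submodule.coe_eq_zero
  inner_op_smul_right := CStarModule.inner_op_smul_right
  inner_smul_right_complex := CStarModule.inner_smul_right_complex
  star_inner _ _ := CStarModule.star_inner _ _
  norm_eq_sqrt_norm_inner_self x := CStarModule.norm_eq_sqrt_norm_inner_self (x : M)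

end Open

/-! ### The Hilbert module `ℓ₂(U)` -/

section EllTwo

variable {X : Type*} [TopologicalSpace X]

theorem summable_of_le {f g : ℕ → C₀(X, ℂ)} (hf : ∀ i, 0 ≤ f i) (hfg : ∀ i, f i ≤ g i)
    (hg : Summable g) : Summable f := by
  rw [summable_iff_vanishing_norm] at hg ⊢
  intro ε hε
  obtain ⟨s, hs⟩ := hg ε hε
  refine ⟨s, fun t ht => lt_of_le_of_lt ?_ (hs t ht)⟩
  exact CStarAlgebra.norm_le_norm_of_nonneg_of_le (Finset.sum_nonneg fun i _ => hf i)
    (Finset.sum_le_sum fun i _ => hfg i)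

/-- `ℓ₂(U) = ℓ₂(C₀(U))`: the sequences `(xᵢ)` in `C₀(U)` for which `∑ xᵢ⋆ xᵢ` converges in norm.
(For series of positive elements, convergence and unconditional convergence agree.) -/
def ellTwo (U : Opens X) : Submodule ℂ (ℕ → C₀(X, ℂ)) where
  carrier := {x | (∀ i, x i ∈ openIdeal U) ∧ Summable fun i => star (x i) * x i}
  zero_mem' := ⟨fun _ => Submodule.zero_mem _, by simp⟩
  add_mem' {x y} hx hy := by
    refine ⟨fun i => Submodule.add_mem _ (hx.1 i) (hy.1 i), ?_⟩
    refine summable_of_le (fun i => star_mul_self_nonneg _) (fun i => ?_)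
      ((hx.2.add hy.2).const_smul (2 : ℂ))
    have h : (2 : ℂ) • (star (x i) * x i + star (y i) * y i) =
        star ((x + y) i) * (x + y) i + star (x i - y i) * (x i - y i) := by
      ext t
      simp only [ZeroAtInftyContinuousMap.smul_apply, ZeroAtInftyContinuousMap.sub_apply,
        ZeroAtInftyContinuousMap.mul_apply, ZeroAtInftyContinuousMap.star_apply,
        ZeroAtInftyContinuousMap.add_apply, Pi.add_apply, smul_eq_mul, star_add, star_sub]
      ring
    rw [h]
    exact le_add_of_nonneg_right (star_mul_self_nonneg _)
  smul_mem' c x hx := by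
    refine ⟨fun i => Submodule.smul_mem _ c (hx.1 i), ?_⟩
    refine (hx.2.const_smul (star c * c)).congr fun i => ?_
    ext t
    simp only [ZeroAtInftyContinuousMap.smul_apply, ZeroAtInftyContinuousMap.mul_apply,
      ZeroAtInftyContinuousMap.star_apply, Pi.smul_apply, smul_eq_mul, star_mul']
    ring

theorem summable_inner {U : Opens X} (x y : ellTwo U) :
    Summable fun i => star (x.1 i) * y.1 i := by
  have h (c : ℂ) : Summable fun i => star (x.1 i + c • y.1 i) * (x.1 i + c • y.1 i) :=
    (x + c • y).2.2
  have h1 := (h 1).sub (h (-1))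
  have h2 := ((h Complex.I).sub (h (-Complex.I))).const_smul Complex.I
  refine ((h1.sub h2).const_smul (1 / 4 : ℂ)).congr fun i => ?_
  ext t
  simp only [ZeroAtInftyContinuousMap.smul_apply, ZeroAtInftyContinuousMap.sub_apply,
    ZeroAtInftyContinuousMap.mul_apply, ZeroAtInftyContinuousMap.star_apply,
    ZeroAtInftyContinuousMap.add_apply, smul_eq_mul, star_add, star_mul', Complex.star_def,
    map_neg, Complex.conj_I, map_one]
  ring_nf
  simp only [Complex.I_sq]
  ring

instance ellTwo.instInner (U : Opens X) : Inner C₀(X, ℂ) (ellTwo U) :=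
  ⟨fun x y => ∑' i, star (x.1 i) * y.1 i⟩

theorem ellTwo.hasSum_inner {U : Opens X} (x y : ellTwo U) :
    HasSum (fun i => star (x.1 i) * y.1 i) ⟪x, y⟫_(C₀(X, ℂ)) :=
  (summable_inner x y).hasSum

instance ellTwo.instNorm (U : Opens X) : Norm (ellTwo U) := ⟨fun x => √‖⟪x, x⟫_(C₀(X, ℂ))‖⟩

instance ellTwo.instSMul (U : Opens X) : SMul C₀(X, ℂ) (ellTwo U) where
  smul a x := ⟨fun i => a * x.1 i, fun i t ht => by simp [x.2.1 i t ht], by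
    refine (x.2.2.mul_left (star a * a)).congr fun i => ?_
    ext t
    simp only [ZeroAtInftyContinuousMap.mul_apply, ZeroAtInftyContinuousMap.star_apply, star_mul']
    ring⟩

/-- `ℓ₂(U)` is a Hilbert module with `⟨x, y⟩ = ∑ xᵢ⋆ yᵢ` and the coordinatewise action. -/
instance ellTwo.instCStarModule (U : Opens X) : CStarModule C₀(X, ℂ) (ellTwo U) where
  inner_add_right {x y z} := by
    refine (ellTwo.hasSum_inner x (y + z)).unique ?_
    convert (ellTwo.hasSum_inner x y).add (ellTwo.hasSum_inner x z) using 2 with i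
    exact mul_add _ _ _
  inner_self_nonneg {x} := by
    open scoped ComplexOrder in
    intro t
    have h := (ellTwo.hasSum_inner x x).map (evalHom t) (continuous_evalHom t)
    exact h.nonneg fun i => star_mul_self_nonneg (x.1 i t)
  inner_self {x} := by
    open scoped ComplexOrder in
    constructor
    · intro h0
      ext i t
      have h := (ellTwo.hasSum_inner x x).map (evalHom t) (continuous_evalHom t)
      rw [h0, map_zero] at h
      have h1 := (hasSum_zero_iff_of_nonneg (f := fun i => star (x.1 i t) * x.1 i t)
        (fun i => star_mul_self_nonneg _)).1 h
      have h2 : star (x.1 i t) * x.1 i t = 0 := congrFun h1 i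
      simpa using h2
    · rintro rfl
      refine (ellTwo.hasSum_inner (0 : ellTwo U) 0).unique ?_
      simp
  inner_op_smul_right {a x y} := by
    refine (ellTwo.hasSum_inner x (a • y)).unique ?_
    have e : (fun i => star (x.1 i) * (a • y).1 i) = fun i => a * (star (x.1 i) * y.1 i) :=
      funext fun i => mul_left_comm (star (x.1 i)) a (y.1 i)
    rw [e]
    exact (ellTwo.hasSum_inner x y).mul_left a
  inner_smul_right_complex {z x y} := by
    refine (ellTwo.hasSum_inner x (z • y)).unique ?_
    convert (ellTwo.hasSum_inner x y).const_smul z using 2 with i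
    exact mul_smul_comm z (star (x.1 i)) (y.1 i)
  star_inner x y := by
    refine ((ellTwo.hasSum_inner x y).star).unique ?_
    convert ellTwo.hasSum_inner y x using 2 with i
    ext t
    simp only [ZeroAtInftyContinuousMap.mul_apply, ZeroAtInftyContinuousMap.star_apply, star_mul',
      star_star]
    ring
  norm_eq_sqrt_norm_inner_self _ := rfl

end EllTwo

/-! ### The restriction of a module to a closed set -/

section Closed

variable {X : Type*} [TopologicalSpace X]

/-- The complement of an open set, as a subspace. -/
abbrev Compl (U : Opens X) : Type _ := ((U : Set X)ᶜ : Set X)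

/-- The restriction of functions `C₀(X) → C₀(X ∖ U)`. -/
def res (U : Opens X) : C₀(X, ℂ) →ₙₐ[ℂ] C₀(Compl U, ℂ) :=
  ZeroAtInftyContinuousMap.compNonUnitalAlgHom
    { toFun := Subtype.val
      continuous_toFun := continuous_subtype_val
      cocompact_tendsto' := U.isOpen.isClosed_compl.isClosedEmbedding_subtypeVal.tendsto_cocompact }

@[simp]
theorem res_apply (U : Opens X) (f : C₀(X, ℂ)) (x : Compl U) : res U f x = f x := rfl

theorem res_surjective [LocallyCompactSpace X] [T2Space X] (U : Opens X) :
    Function.Surjective (res U) := by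
  intro f
  have hc : IsClosedEmbedding (Subtype.val : Compl U → X) :=
    U.isOpen.isClosed_compl.isClosedEmbedding_subtypeVal
  let e : OnePoint (Compl U) → OnePoint X := OnePoint.map Subtype.val
  have he : Continuous e := by
    refine OnePoint.continuous_map continuous_subtype_val ?_
    simpa using hc.tendsto_cocompact
  have he' : IsClosedEmbedding e :=
    he.isClosedEmbedding (Option.map_injective Subtype.val_injective)
  let f' : C(OnePoint (Compl U), ℂ) :=
    OnePoint.continuousMapMk (f : C(Compl U, ℂ)) 0 (by
      simpa using (zero_at_infty f))
  obtain ⟨g, hg⟩ := ContinuousMap.exists_extension he' f'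
  have hg0 : g OnePoint.infty = 0 := by
    have := DFunLike.congr_fun hg OnePoint.infty
    exact this
  refine ⟨⟨⟨fun x => g x, g.continuous.comp OnePoint.continuous_coe⟩, ?_⟩, ?_⟩
  · have h1 := (g.continuous.tendsto OnePoint.infty).comp OnePoint.tendsto_coe_infty
    rw [hg0, coclosedCompact_eq_cocompact] at h1
    exact h1
  · ext x
    exact DFunLike.congr_fun hg (x : OnePoint (Compl U))

variable (M : Type*) [NormedAddCommGroup M] [NormedSpace ℂ M] [SMul C₀(X, ℂ) M]
  [CStarModule C₀(X, ℂ) M]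

/-- The restriction `M|_{X ∖ U} := M / M C₀(U)` of a Hilbert `C₀(X)`-module to the closed set
`X ∖ U`. -/
abbrev closedPart (U : Opens X) : Type _ := M ⧸ openPart M U

variable {M}

/-- The quotient map `M → M|_{X ∖ U}`. -/
def toClosed (U : Opens X) : M →ₗ[ℂ] closedPart M U := (openPart M U).mkQ

theorem toClosed_surjective (U : Opens X) : Function.Surjective (toClosed (M := M) U) :=
  (openPart M U).mkQ_surjective

theorem toClosed_eq_zero {U : Opens X} {m : M} : toClosed U m = 0 ↔ m ∈ openPart M U :=
  Submodule.Quotient.mk_eq_zero _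

theorem res_inner_congr {U : Opens X} {m m' n n' : M} (hm : toClosed U m = toClosed U m')
    (hn : toClosed U n = toClosed U n') :
    res U ⟪m, n⟫_(C₀(X, ℂ)) = res U ⟪m', n'⟫_(C₀(X, ℂ)) := by
  have key (p q q' : M) (hq : toClosed U q = toClosed U q') :
      res U ⟪p, q⟫_(C₀(X, ℂ)) = res U ⟪p, q'⟫_(C₀(X, ℂ)) := by
    have h : q - q' ∈ openPart M U := by
      rw [← toClosed_eq_zero, map_sub, hq, sub_self]
    ext x
    have := inner_apply_eq_zero p h x.2
    rw [CStarModule.inner_sub_right, ZeroAtInftyContinuousMap.sub_apply] at this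
    exact sub_eq_zero.1 this
  rw [key m n n' hn]
  ext x
  have := DFunLike.congr_fun (key n' m m' hm) x
  simp only [res_apply] at this ⊢
  rw [← CStarModule.star_inner n' m, ← CStarModule.star_inner n' m',
    ZeroAtInftyContinuousMap.star_apply, ZeroAtInftyContinuousMap.star_apply, this]

/-- The `C₀(X ∖ U)`-valued inner product on `M|_{X ∖ U}`: the inner product of two classes is the
restriction to `X ∖ U` of the inner product of any representatives. -/
instance closedPart.instInner (U : Opens X) : Inner C₀(Compl U, ℂ) (closedPart M U) :=
  ⟨fun p q => res U ⟪Function.surjInv (toClosed_surjective U) p,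
    Function.surjInv (toClosed_surjective U) q⟫_(C₀(X, ℂ))⟩

@[simp]
theorem inner_toClosed (U : Opens X) (m n : M) :
    ⟪toClosed U m, toClosed U n⟫_(C₀(Compl U, ℂ)) = res U ⟪m, n⟫_(C₀(X, ℂ)) :=
  res_inner_congr (Function.surjInv_eq _ _) (Function.surjInv_eq _ _)

section Action

variable [LocallyCompactSpace X] [T2Space X]

/-- The action of `C₀(X ∖ U) ≅ C₀(X) / C₀(U)` on `M|_{X ∖ U}`: a function acts through any
extension of it to a function in `C₀(X)`, applied to any representative. -/
instance closedPart.instSMul (U : Opens X) : SMul C₀(Compl U, ℂ) (closedPart M U) :=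
  ⟨fun a p => toClosed U (Function.surjInv (res_surjective U) a •
    Function.surjInv (toClosed_surjective U) p)⟩

@[simp]
theorem res_act_toClosed (U : Opens X) (a : C₀(X, ℂ)) (m : M) :
    res U a • toClosed U m = toClosed U (a • m) := by
  set b := Function.surjInv (res_surjective U) (res U a) with hb
  set n := Function.surjInv (toClosed_surjective U) (toClosed U m) with hn
  have hb' : res U b = res U a := Function.surjInv_eq _ _
  have hn' : toClosed U n = toClosed U m := Function.surjInv_eq _ _
  have h1 : b - a ∈ openIdeal U := fun x hx => by
    have := DFunLike.congr_fun hb' ⟨x, hx⟩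
    simpa [sub_eq_zero] using this
  have h2 : n - m ∈ openPart M U := by
    rw [← toClosed_eq_zero, map_sub, hn', sub_self]
  have h3 : b • n - a • m = b • (n - m) + (b - a) • m := by
    rw [sub_act, sub_eq_add_neg n m, act_add, ← neg_one_smul ℂ m, act_smul, neg_one_smul]
    abel
  change toClosed U (b • n) = toClosed U (a • m)
  rw [← sub_eq_zero, ← map_sub, toClosed_eq_zero, h3]
  exact Submodule.add_mem _ (act_mem_of_mem _ h2) (act_mem_openPart h1 _)

end Action

theorem norm_res_le (U : Opens X) (f : C₀(X, ℂ)) : ‖res U f‖ ≤ ‖f‖ :=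
  norm_le_of (norm_nonneg f) fun x => norm_apply_le f x

/-- The quotient norm on `M|_{X ∖ U}` is the norm of its inner product. -/
theorem norm_toClosed (U : Opens X) (m : M) :
    ‖toClosed U m‖ = √‖res U ⟪m, m⟫_(C₀(X, ℂ))‖ := by
  apply le_antisymm
  · set f : C₀(X, ℂ) := ⟪m, m⟫_(C₀(X, ℂ)) with hf
    set c : ℝ := ‖res U f‖ with hc
    have hc0 : 0 ≤ c := norm_nonneg _
    refine Real.le_sqrt_of_sq_le (le_of_forall_pos_le_add fun ε hε => ?_)
    let h : ℝ → ℝ := fun s => max (s - c) 0 / (max (s - c) 0 + ε)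
    have hpos (s : ℝ) : 0 < max (s - c) 0 + ε := by positivity
    have hcont : Continuous h :=
      Continuous.div (by fun_prop) (by fun_prop) fun s => (hpos s).ne'
    have hh0 : ∀ s ≤ c, h s = 0 := fun s hs => by
      simp [h, max_eq_right (sub_nonpos.2 hs)]
    have hcont' : Continuous fun z : ℂ => ((h ‖z‖ : ℝ) : ℂ) :=
      Complex.continuous_ofReal.comp (hcont.comp continuous_norm)
    let a : C₀(X, ℂ) := ⟨⟨fun x => ((h ‖f x‖ : ℝ) : ℂ), hcont'.comp (map_continuous f)⟩, by
      have := (hcont'.tendsto 0).comp (zero_at_infty f)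
      simp only [norm_zero, hh0 0 hc0, Complex.ofReal_zero] at this
      exact this⟩
    have ha (x : X) : a x = ((h ‖f x‖ : ℝ) : ℂ) := rfl
    have haU : a ∈ openIdeal U := fun x hx => by
      rw [ha, hh0, Complex.ofReal_zero]
      exact norm_apply_le (res U f) ⟨x, hx⟩
    have hq : toClosed U m = toClosed U (m - a • m) := by
      rw [map_sub, toClosed_eq_zero.2 (act_mem_openPart haU m), sub_zero]
    have hin (x : X) : (⟪m - a • m, m - a • m⟫_(C₀(X, ℂ))) x
        = (((1 - h ‖f x‖) ^ 2 : ℝ) : ℂ) * f x := by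
      simp only [CStarModule.inner_sub_left, CStarModule.inner_sub_right,
        CStarModule.inner_op_smul_left, CStarModule.inner_op_smul_right,
        ZeroAtInftyContinuousMap.sub_apply, ZeroAtInftyContinuousMap.mul_apply,
        ZeroAtInftyContinuousMap.star_apply, ha, Complex.star_def, Complex.conj_ofReal, ← hf]
      push_cast
      ring
    calc ‖toClosed U m‖ ^ 2 ≤ ‖m - a • m‖ ^ 2 := by
          rw [hq]
          gcongr
          exact Submodule.Quotient.norm_mk_le _ _
      _ = ‖⟪m - a • m, m - a • m⟫_(C₀(X, ℂ))‖ := CStarModule.norm_sq_eq _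
      _ ≤ c + ε := by
          refine norm_le_of (by positivity) fun x => ?_
          rw [hin, norm_mul, Complex.norm_real, Real.norm_of_nonneg (sq_nonneg _)]
          set s := ‖f x‖
          set t := max (s - c) 0 with ht
          have ht0 : 0 ≤ t := le_max_right _ _
          have hst : s ≤ c + t := by
            have := le_max_left (s - c) 0
            linarith
          have h1 : 1 - h s = ε / (t + ε) := by
            have : t + ε ≠ 0 := by positivity
            simp only [h, ← ht]
            field_simp
            ring
          rw [h1, div_pow, div_mul_eq_mul_div, div_le_iff₀ (by positivity)]
          calc ε ^ 2 * s ≤ ε ^ 2 * (c + t) := by gcongr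
            _ ≤ (c + ε) * (t + ε) ^ 2 := by
              have e1 : 0 ≤ c * (t ^ 2 + 2 * t * ε) := by positivity
              have e2 : 0 ≤ ε * (t ^ 2 + t * ε + ε ^ 2) := by positivity
              nlinarith
  · refine Real.sqrt_le_iff.2 ⟨norm_nonneg _, ?_⟩
    refine le_of_forall_gt_imp_ge_of_dense fun r hr => ?_
    obtain ⟨δ, hδ, hδr⟩ : ∃ δ > 0, (‖toClosed U m‖ + δ) ^ 2 < r := by
      have hcont : Continuous fun δ : ℝ => (‖toClosed U m‖ + δ) ^ 2 := by fun_prop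
      have := (hcont.tendsto 0).eventually_lt_const (u := r) (by simpa using hr)
      obtain ⟨δ, h1, h2⟩ := ((this.filter_mono nhdsWithin_le_nhds).and
        (self_mem_nhdsWithin (a := (0 : ℝ)) (s := Set.Ioi 0))).exists
      exact ⟨δ, h2, h1⟩
    obtain ⟨n, hn, hn'⟩ := QuotientAddGroup.exists_norm_mk_lt (S := (openPart M U).toAddSubgroup)
      (toClosed U m) hδ
    have hn'' : toClosed U m = toClosed U n := hn.symm
    rw [res_inner_congr hn'' hn'']
    calc ‖res U ⟪n, n⟫_(C₀(X, ℂ))‖ ≤ ‖⟪n, n⟫_(C₀(X, ℂ))‖ := norm_res_le U _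
      _ = ‖n‖ ^ 2 := (CStarModule.norm_sq_eq _).symm
      _ ≤ (‖toClosed U m‖ + δ) ^ 2 := pow_le_pow_left₀ (norm_nonneg n) hn'.le 2
      _ ≤ r := hδr.le

/-- `M|_{X ∖ U}` is a Hilbert `C₀(X ∖ U)`-module. -/
instance closedPart.instCStarModule [LocallyCompactSpace X] [T2Space X] (U : Opens X) :
    CStarModule C₀(Compl U, ℂ) (closedPart M U) where
  inner_add_right {p q r} := by
    obtain ⟨p, rfl⟩ := toClosed_surjective U p
    obtain ⟨q, rfl⟩ := toClosed_surjective U q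
    obtain ⟨r, rfl⟩ := toClosed_surjective U r
    rw [← map_add, inner_toClosed, inner_toClosed, inner_toClosed, CStarModule.inner_add_right,
      map_add]
  inner_self_nonneg {p} := by
    obtain ⟨p, rfl⟩ := toClosed_surjective U p
    rw [inner_toClosed]
    exact fun x => (CStarModule.inner_self_nonneg (A := C₀(X, ℂ)) (x := p)) x
  inner_self {p} := by
    obtain ⟨p, rfl⟩ := toClosed_surjective U p
    rw [inner_toClosed, ← norm_eq_zero (a := toClosed U p), norm_toClosed,
      Real.sqrt_eq_zero (norm_nonneg _), norm_eq_zero]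
  inner_op_smul_right {a p q} := by
    obtain ⟨p, rfl⟩ := toClosed_surjective U p
    obtain ⟨q, rfl⟩ := toClosed_surjective U q
    obtain ⟨a, rfl⟩ := res_surjective U a
    rw [res_act_toClosed]
    simp only [inner_toClosed, CStarModule.inner_op_smul_right, map_mul]
  inner_smul_right_complex {z p q} := by
    obtain ⟨p, rfl⟩ := toClosed_surjective U p
    obtain ⟨q, rfl⟩ := toClosed_surjective U q
    rw [← map_smul, inner_toClosed, inner_toClosed, CStarModule.inner_smul_right_complex, map_smul]
  star_inner p q := by
    obtain ⟨p, rfl⟩ := toClosed_surjective U p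
    obtain ⟨q, rfl⟩ := toClosed_surjective U q
    simp only [inner_toClosed]
    rw [← CStarModule.star_inner p q]
    rfl
  norm_eq_sqrt_norm_inner_self p := by
    obtain ⟨p, rfl⟩ := toClosed_surjective U p
    rw [inner_toClosed, norm_toClosed]

end Closed

end HilbertC0

end

noncomputable section

set_option linter.unusedSectionVars false

namespace HilbertC0

/-! ### Square roots in Banach algebras -/

section SqrtIter

variable (𝕜 : Type*) {R : Type*} [NormedField 𝕜] [NormedRing R] [NormedAlgebra 𝕜 R]

/-- The iteration `y ↦ (b + y²) / 2`, whose limit `y` satisfies `(1 - y)² = 1 - b`. -/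
def sqrtIter (b : R) : ℕ → R
  | 0 => 0
  | n + 1 => (2⁻¹ : 𝕜) • (b + sqrtIter b n * sqrtIter b n)

theorem sqrtIter_one_mem (n : ℕ) : sqrtIter ℝ (1 : ℝ) n ∈ Set.Icc (0 : ℝ) 1 := by
  induction n with
  | zero => simp [sqrtIter]
  | succ n ih =>
    obtain ⟨h0, h1⟩ := ih
    simp only [sqrtIter, smul_eq_mul, Set.mem_Icc]
    constructor <;> nlinarith

theorem sqrtIter_one_mono : Monotone (sqrtIter ℝ (1 : ℝ)) := by
  refine monotone_nat_of_le_succ fun n => ?_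
  simp only [sqrtIter, smul_eq_mul]
  nlinarith [sq_nonneg (sqrtIter ℝ (1 : ℝ) n - 1)]

theorem tendsto_sqrtIter_one : Tendsto (sqrtIter ℝ (1 : ℝ)) atTop (𝓝 1) := by
  obtain ⟨l, hl⟩ : ∃ l, Tendsto (sqrtIter ℝ (1 : ℝ)) atTop (𝓝 l) :=
    ⟨_, tendsto_atTop_ciSup sqrtIter_one_mono ⟨1, by
      rintro _ ⟨n, rfl⟩
      exact (sqrtIter_one_mem n).2⟩⟩
  have h1 : Tendsto (fun n => sqrtIter ℝ (1 : ℝ) (n + 1)) atTop (𝓝 l) :=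
    hl.comp (tendsto_add_atTop_nat 1)
  have h2 : Tendsto (fun n => sqrtIter ℝ (1 : ℝ) (n + 1)) atTop (𝓝 ((2⁻¹ : ℝ) • (1 + l * l))) :=
    ((hl.mul hl).const_add 1).const_smul (2⁻¹ : ℝ)
  have h3 := tendsto_nhds_unique h1 h2
  have h4 : l = 1 := by
    simp only [smul_eq_mul] at h3
    nlinarith [sq_nonneg (l - 1)]
  rwa [h4] at hl

variable {𝕜}

theorem commute_sqrtIter {b c : R} (h : Commute c b) (n : ℕ) : Commute c (sqrtIter 𝕜 b n) := by
  induction n with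
  | zero => exact Commute.zero_right c
  | succ n ih => exact (h.add_right (ih.mul_right ih)).smul_right _

end SqrtIter

section SqrtIter

variable {𝕜 : Type*} {R : Type*} [RCLike 𝕜] [NormedRing R] [NormedAlgebra 𝕜 R]

theorem norm_half_smul_le {a : R} {r : ℝ} (h : ‖a‖ ≤ r) : ‖(2⁻¹ : 𝕜) • a‖ ≤ 2⁻¹ * r := by
  rw [norm_smul, norm_inv, RCLike.norm_ofNat]
  gcongr

theorem norm_sqrtIter_le {b : R} (hb : ‖b‖ ≤ 1) (n : ℕ) :
    ‖sqrtIter 𝕜 b n‖ ≤ sqrtIter ℝ (1 : ℝ) n := by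
  induction n with
  | zero => simp [sqrtIter]
  | succ n ih =>
    refine norm_half_smul_le ((norm_add_le _ _).trans (add_le_add hb ((norm_mul_le _ _).trans ?_)))
    exact mul_le_mul ih ih (norm_nonneg _) (sqrtIter_one_mem n).1

theorem norm_sqrtIter_succ_sub_le {b : R} (hb : ‖b‖ ≤ 1) (n : ℕ) :
    ‖sqrtIter 𝕜 b (n + 1) - sqrtIter 𝕜 b n‖ ≤
      sqrtIter ℝ (1 : ℝ) (n + 1) - sqrtIter ℝ (1 : ℝ) n := by
  induction n with
  | zero => simpa [sqrtIter] using norm_half_smul_le (𝕜 := 𝕜) hb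
  | succ n ih =>
    have hc : Commute (sqrtIter 𝕜 b (n + 1)) (sqrtIter 𝕜 b n) :=
      commute_sqrtIter (commute_sqrtIter (Commute.refl b) (n + 1)).symm n
    have e : sqrtIter 𝕜 b (n + 1 + 1) - sqrtIter 𝕜 b (n + 1) = (2⁻¹ : 𝕜) •
        ((sqrtIter 𝕜 b (n + 1) + sqrtIter 𝕜 b n) * (sqrtIter 𝕜 b (n + 1) - sqrtIter 𝕜 b n)) := by
      rw [← hc.mul_self_sub_mul_self_eq]
      conv_lhs => rw [sqrtIter]; arg 2; rw [sqrtIter]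
      rw [← smul_sub]
      congr 1
      abel
    have e' : sqrtIter ℝ (1 : ℝ) (n + 1 + 1) - sqrtIter ℝ (1 : ℝ) (n + 1) = (2⁻¹ : ℝ) *
        ((sqrtIter ℝ (1 : ℝ) (n + 1) + sqrtIter ℝ (1 : ℝ) n) *
          (sqrtIter ℝ (1 : ℝ) (n + 1) - sqrtIter ℝ (1 : ℝ) n)) := by
      conv_lhs => rw [sqrtIter]; arg 2; rw [sqrtIter]
      simp only [smul_eq_mul]
      ring
    rw [e, e']
    refine norm_half_smul_le ((norm_mul_le _ _).trans ?_)
    exact mul_le_mul ((norm_add_le _ _).trans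
      (add_le_add (norm_sqrtIter_le hb _) (norm_sqrtIter_le hb _))) ih (norm_nonneg _)
      (add_nonneg (sqrtIter_one_mem _).1 (sqrtIter_one_mem _).1)

theorem exists_tendsto_sqrtIter [CompleteSpace R] {b : R} (hb : ‖b‖ ≤ 1) :
    ∃ y : R, Tendsto (sqrtIter 𝕜 b) atTop (𝓝 y) ∧ (1 - y) * (1 - y) = 1 - b := by
  have hs : Summable fun n => sqrtIter ℝ (1 : ℝ) (n + 1) - sqrtIter ℝ (1 : ℝ) n := by
    refine summable_of_sum_range_le (c := 1) (fun n => sub_nonneg.2 (sqrtIter_one_mono n.le_succ))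
      fun n => ?_
    rw [Finset.sum_range_sub]
    simpa [sqrtIter] using (sqrtIter_one_mem n).2
  obtain ⟨y, hy⟩ := cauchySeq_tendsto_of_complete (cauchySeq_of_dist_le_of_summable
    (f := sqrtIter 𝕜 b) _ (fun n => by
      rw [dist_comm, dist_eq_norm]
      exact norm_sqrtIter_succ_sub_le hb n) hs)
  refine ⟨y, hy, ?_⟩
  have h1 : Tendsto (fun n => sqrtIter 𝕜 b (n + 1)) atTop (𝓝 y) :=
    hy.comp (tendsto_add_atTop_nat 1)
  have h2 : Tendsto (fun n => sqrtIter 𝕜 b (n + 1)) atTop (𝓝 ((2⁻¹ : 𝕜) • (b + y * y))) :=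
    ((hy.mul hy).const_add b).const_smul (2⁻¹ : 𝕜)
  have h3 : (2 : 𝕜) • y = b + y * y := by
    conv_lhs => rw [tendsto_nhds_unique h1 h2]
    rw [smul_inv_smul₀ two_ne_zero]
  rw [two_smul] at h3
  have h4 : b = y + y - y * y := by rw [h3]; abel
  rw [h4]
  noncomm_ring

theorem tendsto_sqrtIter_of_norm_le {b y : R} (hb : ‖b‖ ≤ 1) (hy : ‖y‖ ≤ 1)
    (h : (1 - y) * (1 - y) = 1 - b) : Tendsto (sqrtIter 𝕜 b) atTop (𝓝 y) := by
  have hby : b + y * y = (2 : 𝕜) • y := by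
    have : b = 1 - (1 - y) * (1 - y) := by rw [h]; abel
    rw [this, two_smul]
    noncomm_ring
  have hc : Commute y b := by
    have : b = (2 : 𝕜) • y - y * y := by rw [← hby]; abel
    rw [this]
    exact ((Commute.refl y).smul_right _).sub_right ((Commute.refl y).mul_right (Commute.refl y))
  have key (n : ℕ) : ‖y - sqrtIter 𝕜 b n‖ ≤ 1 - sqrtIter ℝ (1 : ℝ) n := by
    induction n with
    | zero => simpa [sqrtIter] using hy
    | succ n ih =>
      have e : y - sqrtIter 𝕜 b (n + 1) =
          (2⁻¹ : 𝕜) • ((y + sqrtIter 𝕜 b n) * (y - sqrtIter 𝕜 b n)) := by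
        rw [← (commute_sqrtIter hc n).mul_self_sub_mul_self_eq]
        have : y = (2⁻¹ : 𝕜) • (b + y * y) := by rw [hby, inv_smul_smul₀ two_ne_zero]
        conv_lhs => rw [this, sqrtIter]
        rw [← smul_sub]
        congr 1
        abel
      have e' : 1 - sqrtIter ℝ (1 : ℝ) (n + 1) =
          (2⁻¹ : ℝ) * ((1 + sqrtIter ℝ (1 : ℝ) n) * (1 - sqrtIter ℝ (1 : ℝ) n)) := by
        simp only [sqrtIter, smul_eq_mul]
        ring
      rw [e, e']
      refine norm_half_smul_le ((norm_mul_le _ _).trans ?_)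
      exact mul_le_mul ((norm_add_le _ _).trans (add_le_add hy (norm_sqrtIter_le hb _))) ih
        (norm_nonneg _) (add_nonneg zero_le_one (sqrtIter_one_mem _).1)
  rw [tendsto_iff_norm_sub_tendsto_zero]
  have h0 : Tendsto (fun n => 1 - sqrtIter ℝ (1 : ℝ) n) atTop (𝓝 0) := by
    simpa using tendsto_sqrtIter_one.const_sub 1
  exact squeeze_zero (fun _ => norm_nonneg _) (fun n => by rw [norm_sub_rev]; exact key n) h0

end SqrtIter

/-! ### Pointwise inequalities for operators on Hilbert `C₀(X)`-modules -/

section Pointwise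

variable {X : Type*} [TopologicalSpace X]
variable {M : Type*} [NormedAddCommGroup M] [NormedSpace ℂ M] [SMul C₀(X, ℂ) M]
  [CStarModule C₀(X, ℂ) M]
variable {N : Type*} [NormedAddCommGroup N] [NormedSpace ℂ N] [SMul C₀(X, ℂ) N]
  [CStarModule C₀(X, ℂ) N]

open scoped ComplexOrder in
theorem inner_self_apply_nonneg (x : M) (t : X) : 0 ≤ (⟪x, x⟫_(C₀(X, ℂ))) t :=
  (CStarModule.inner_self_nonneg (A := C₀(X, ℂ)) (x := x)) t

/-- `P` is symmetric and positive for the `C₀(X)`-valued inner product. -/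
structure IsPos (P : M →L[ℂ] M) : Prop where
  symm : ∀ x y, ⟪P x, y⟫_(C₀(X, ℂ)) = ⟪x, P y⟫_(C₀(X, ℂ))
  nonneg : ∀ x, 0 ≤ ⟪x, P x⟫_(C₀(X, ℂ))

/-- The Cauchy–Schwarz inequality at a point, for the form defined by a positive operator. -/
theorem IsPos.norm_inner_sq_le {P : M →L[ℂ] M} (hP : IsPos (X := X) P) (x y : M) (t : X) :
    ‖(⟪x, P y⟫_(C₀(X, ℂ))) t‖ ^ 2 ≤
      ‖(⟪x, P x⟫_(C₀(X, ℂ))) t‖ * ‖(⟪y, P y⟫_(C₀(X, ℂ))) t‖ := by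
  let c : PreInnerProductSpace.Core ℂ M :=
    { inner := fun x y => (⟪x, P y⟫_(C₀(X, ℂ))) t
      conj_inner_symm := fun x y => by
        rw [← hP.symm x y, ← CStarModule.star_inner y (P x), ZeroAtInftyContinuousMap.star_apply]
        rfl
      re_inner_nonneg := fun x => (Complex.nonneg_iff.1 (hP.nonneg x t)).1
      add_left := fun x y z => by simp
      smul_left := fun x y r => by simp }
  have h := @InnerProductSpace.Core.inner_mul_inner_self_le ℂ M _ _ _ c x y
  have e (x : M) : RCLike.re (@inner ℂ M c.toInner x x) = ‖(⟪x, P x⟫_(C₀(X, ℂ))) t‖ := by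
    change ((⟪x, P x⟫_(C₀(X, ℂ))) t).re = _
    exact Complex.re_eq_norm.2 (hP.nonneg x t)
  rw [e, e] at h
  have e2 : ‖@inner ℂ M c.toInner y x‖ = ‖@inner ℂ M c.toInner x y‖ := by
    rw [← c.conj_inner_symm x y, RCLike.norm_conj]
  rw [e2, ← sq] at h
  exact h

theorem isPos_id : IsPos (X := X) (ContinuousLinearMap.id ℂ M) :=
  ⟨fun _ _ => rfl, fun _ => CStarModule.inner_self_nonneg⟩

theorem norm_inner_apply_sq_le (x y : M) (t : X) :
    ‖(⟪x, y⟫_(C₀(X, ℂ))) t‖ ^ 2 ≤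
      ‖(⟪x, x⟫_(C₀(X, ℂ))) t‖ * ‖(⟪y, y⟫_(C₀(X, ℂ))) t‖ :=
  isPos_id.norm_inner_sq_le x y t

theorem norm_le_of_inner_apply_le {x : M} {C : ℝ} (hC : 0 ≤ C)
    (h : ∀ t, ‖(⟪x, x⟫_(C₀(X, ℂ))) t‖ ≤ C ^ 2) : ‖x‖ ≤ C := by
  rw [CStarModule.norm_eq_sqrt_norm_inner_self (A := C₀(X, ℂ)) x]
  exact Real.sqrt_le_iff.2 ⟨hC, norm_le_of (sq_nonneg C) h⟩

theorem norm_inner_self_apply_le (x : M) (t : X) : ‖(⟪x, x⟫_(C₀(X, ℂ))) t‖ ≤ ‖x‖ ^ 2 := by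
  rw [CStarModule.norm_sq_eq C₀(X, ℂ)]
  exact norm_apply_le _ t

theorem norm_inner_act_apply (a : C₀(X, ℂ)) (y : M) (t : X) :
    ‖(⟪a • y, a • y⟫_(C₀(X, ℂ))) t‖ = ‖a t‖ ^ 2 * ‖(⟪y, y⟫_(C₀(X, ℂ))) t‖ := by
  simp only [CStarModule.inner_op_smul_left, CStarModule.inner_op_smul_right,
    ZeroAtInftyContinuousMap.mul_apply, ZeroAtInftyContinuousMap.star_apply, norm_mul, norm_star]
  ring

/-- A contractive module map is contractive at every point. -/
theorem norm_inner_map_apply_le [LocallyCompactSpace X] [T2Space X] {S : M →L[ℂ] N}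
    (hS : ∀ (a : C₀(X, ℂ)) x, S (a • x) = a • S x) (hS1 : ‖S‖ ≤ 1) (x : M) (t : X) :
    ‖(⟪S x, S x⟫_(C₀(X, ℂ))) t‖ ≤ ‖(⟪x, x⟫_(C₀(X, ℂ))) t‖ := by
  refine le_of_forall_pos_le_add fun ε hε => ?_
  set f : C₀(X, ℂ) := ⟪x, x⟫_(C₀(X, ℂ)) with hf
  obtain ⟨χ, h1, -, hχ, h01⟩ := exists_continuous_one_zero_of_isCompact (isCompact_singleton (x := t))
    isClosed_empty (Set.disjoint_empty _)
  have hχ' : Tendsto χ (cocompact X) (𝓝 0) := hχ.is_zero_at_infty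
  let r : X → ℝ := fun s => χ s / √(‖f s‖ + ε)
  have hpos (s : X) : 0 < ‖f s‖ + ε := by positivity
  have hr : Continuous r := by
    refine χ.continuous.div ?_ fun s => (Real.sqrt_pos.2 (hpos s)).ne'
    exact Real.continuous_sqrt.comp ((map_continuous f).norm.add continuous_const)
  have hr0 : Tendsto r (cocompact X) (𝓝 0) := by
    have : Tendsto (fun s => χ s / √ε) (cocompact X) (𝓝 0) := by
      simpa using hχ'.div_const (√ε)
    refine squeeze_zero (fun s => div_nonneg (h01 s).1 (Real.sqrt_nonneg _)) (fun s => ?_) this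
    refine div_le_div_of_nonneg_left (h01 s).1 (Real.sqrt_pos.2 hε) (Real.sqrt_le_sqrt ?_)
    linarith [norm_nonneg (f s)]
  let a : C₀(X, ℂ) := ⟨⟨fun s => (r s : ℂ), Complex.continuous_ofReal.comp hr⟩, by
    have := (Complex.continuous_ofReal.tendsto 0).comp hr0
    rwa [Complex.ofReal_zero] at this⟩
  have ha (s : X) : a s = (r s : ℂ) := rfl
  have hr2 (s : X) : r s ^ 2 = χ s ^ 2 / (‖f s‖ + ε) := by
    rw [div_pow, Real.sq_sqrt (hpos s).le]
  have har (s : X) : ‖a s‖ ^ 2 = r s ^ 2 := by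
    rw [ha, Complex.norm_real, Real.norm_eq_abs, sq_abs]
  have hax : ‖a • x‖ ≤ 1 := by
    refine norm_le_of_inner_apply_le (X := X) zero_le_one fun s => ?_
    rw [norm_inner_act_apply, har, hr2, ← hf, one_pow, div_mul_eq_mul_div, div_le_one (hpos s)]
    have := (h01 s)
    have h2 : χ s ^ 2 ≤ 1 := pow_le_one₀ this.1 this.2
    nlinarith [norm_nonneg (f s)]
  have hSax : ‖a • S x‖ ≤ 1 := by
    rw [← hS]
    exact (S.le_opNorm _).trans (mul_le_one₀ hS1 (norm_nonneg _) hax)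
  have h3 : r t ^ 2 * ‖(⟪S x, S x⟫_(C₀(X, ℂ))) t‖ ≤ 1 := by
    rw [← har, ← norm_inner_act_apply]
    refine (norm_inner_self_apply_le (a • S x) t).trans ?_
    exact pow_le_one₀ (norm_nonneg _) hSax
  have h4 : χ t = 1 := h1 (Set.mem_singleton t)
  rw [hr2, h4, one_pow, one_div, inv_mul_le_iff₀ (hpos t), mul_one] at h3
  exact h3

theorem map_act_of_adjoint {S : M → N} {S' : N → M}
    (h : ∀ x y, ⟪S x, y⟫_(C₀(X, ℂ)) = ⟪x, S' y⟫_(C₀(X, ℂ))) (a : C₀(X, ℂ)) (x : M) :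
    S (a • x) = a • S x := by
  refine ext_inner (A := C₀(X, ℂ)) fun z => ?_
  have h' (u : M) : ⟪z, S u⟫_(C₀(X, ℂ)) = ⟪S' z, u⟫_(C₀(X, ℂ)) := by
    rw [← CStarModule.star_inner (S u) z, h, CStarModule.star_inner]
  rw [h', CStarModule.inner_op_smul_right, CStarModule.inner_op_smul_right, h']

namespace IsPos

variable {P : M →L[ℂ] M}

theorem map_act (hP : IsPos (X := X) P) (a : C₀(X, ℂ)) (x : M) : P (a • x) = a • P x :=
  map_act_of_adjoint hP.symm a x

section

variable [LocallyCompactSpace X] [T2Space X]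

theorem inner_apply_le_self (hP : IsPos (X := X) P) (h1 : ‖P‖ ≤ 1) (x : M) (t : X) :
    ‖(⟪x, P x⟫_(C₀(X, ℂ))) t‖ ≤ ‖(⟪x, x⟫_(C₀(X, ℂ))) t‖ := by
  refine (pow_le_pow_iff_left₀ (norm_nonneg _) (norm_nonneg _) two_ne_zero).1 ?_
  refine (norm_inner_apply_sq_le x (P x) t).trans ?_
  rw [sq]
  gcongr
  exact norm_inner_map_apply_le hP.map_act h1 x t

theorem norm_map_apply_le (hP : IsPos (X := X) P) (h1 : ‖P‖ ≤ 1) (x : M) (t : X) :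
    ‖(⟪P x, P x⟫_(C₀(X, ℂ))) t‖ ≤ ‖(⟪x, P x⟫_(C₀(X, ℂ))) t‖ := by
  have h := hP.norm_inner_sq_le x (P x) t
  rw [← hP.symm x (P x)] at h
  have h2 := hP.inner_apply_le_self h1 (P x) t
  have h3 := h.trans (mul_le_mul_of_nonneg_left h2 (norm_nonneg _))
  rcases (norm_nonneg ((⟪P x, P x⟫_(C₀(X, ℂ))) t)).eq_or_lt with h0 | h0
  · rw [← h0]
    exact norm_nonneg _
  · rw [sq] at h3
    exact le_of_mul_le_mul_right h3 h0

theorem norm_inner_sub_apply_le (hP : IsPos (X := X) P) (h1 : ‖P‖ ≤ 1) (x : M) (t : X) :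
    ‖(⟪x - P x, x - P x⟫_(C₀(X, ℂ))) t‖ + ‖(⟪x, P x⟫_(C₀(X, ℂ))) t‖ ≤
      ‖(⟪x, x⟫_(C₀(X, ℂ))) t‖ := by
  have h := hP.norm_map_apply_le h1 x t
  have e : (⟪x - P x, x - P x⟫_(C₀(X, ℂ))) t = (⟪x, x⟫_(C₀(X, ℂ))) t -
      (⟪x, P x⟫_(C₀(X, ℂ))) t - (⟪x, P x⟫_(C₀(X, ℂ))) t + (⟪P x, P x⟫_(C₀(X, ℂ))) t := by
    simp only [CStarModule.inner_sub_left, CStarModule.inner_sub_right,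
      ZeroAtInftyContinuousMap.sub_apply, hP.symm x x]
    ring
  have r1 := Complex.re_eq_norm.2 (inner_self_apply_nonneg (x - P x) t)
  have r2 := Complex.re_eq_norm.2 (inner_self_apply_nonneg x t)
  have r3 := Complex.re_eq_norm.2 (hP.nonneg x t)
  have r4 := Complex.re_eq_norm.2 (inner_self_apply_nonneg (P x) t)
  have e' := congrArg Complex.re e
  simp only [Complex.add_re, Complex.sub_re] at e'
  change (((⟪x, P x⟫_(C₀(X, ℂ))) t)).re = _ at r3
  linarith

theorem norm_one_sub_le (hP : IsPos (X := X) P) (h1 : ‖P‖ ≤ 1) : ‖1 - P‖ ≤ 1 := by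
  refine ContinuousLinearMap.opNorm_le_bound _ zero_le_one fun x => ?_
  rw [one_mul]
  refine norm_le_of_inner_apply_le (X := X) (norm_nonneg x) fun t => ?_
  have h := hP.norm_inner_sub_apply_le h1 x t
  have h2 := norm_inner_self_apply_le x t
  change ‖(⟪x - P x, x - P x⟫_(C₀(X, ℂ))) t‖ ≤ _
  linarith [norm_nonneg ((⟪x, P x⟫_(C₀(X, ℂ))) t)]

/-- If `|⟨y, x⟩|² ≤ C ⟨x, P x⟩` at every point for all `x`, then `y` is in the closure of the range
of `P`. -/
theorem mem_closure_range (hP : IsPos (X := X) P) (h1 : ‖P‖ ≤ 1) {y : M} {C : ℝ}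
    (hC : 0 ≤ C) (hy : ∀ x t, ‖(⟪y, x⟫_(C₀(X, ℂ))) t‖ ^ 2 ≤ C * ‖(⟪x, P x⟫_(C₀(X, ℂ))) t‖) :
    y ∈ closure (Set.range P) := by
  let r : ℕ → M := fun n => ((1 - P) ^ n) y
  have hr0 : r 0 = y := rfl
  have hrs (n : ℕ) : r (n + 1) = r n - P (r n) := by
    simp only [r, pow_succ']
    rfl
  have hsymm (x z : M) : ⟪(1 - P) x, z⟫_(C₀(X, ℂ)) = ⟪x, (1 - P) z⟫_(C₀(X, ℂ)) := by
    change ⟪x - P x, z⟫_(C₀(X, ℂ)) = ⟪x, z - P z⟫_(C₀(X, ℂ))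
    simp [hP.symm]
  have hsymmn (n : ℕ) (x z : M) :
      ⟪((1 - P) ^ n) x, z⟫_(C₀(X, ℂ)) = ⟪x, ((1 - P) ^ n) z⟫_(C₀(X, ℂ)) := by
    induction n generalizing x z with
    | zero => rfl
    | succ n ih =>
      rw [pow_succ]
      change ⟪((1 - P) ^ n) ((1 - P) x), z⟫_(C₀(X, ℂ)) = _
      rw [ih, hsymm, ← pow_succ, pow_succ']
      rfl
  let a : X → ℕ → ℝ := fun t n => ‖(⟪r n, r n⟫_(C₀(X, ℂ))) t‖
  have hstep (t : X) (n : ℕ) : a t (n + 1) + ‖(⟪r n, P (r n)⟫_(C₀(X, ℂ))) t‖ ≤ a t n := by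
    simp only [a, hrs]
    exact hP.norm_inner_sub_apply_le h1 (r n) t
  have hanti (t : X) : Antitone (a t) := antitone_nat_of_succ_le fun n => by
    have := hstep t n
    linarith [norm_nonneg ((⟪r n, P (r n)⟫_(C₀(X, ℂ))) t)]
  have hsq (t : X) (n : ℕ) : a t n ^ 2 ≤ C * (a t (2 * n) - a t (2 * n + 1)) := by
    have e : ⟪r n, r n⟫_(C₀(X, ℂ)) = ⟪y, r (2 * n)⟫_(C₀(X, ℂ)) := by
      simp only [r]
      rw [hsymmn, two_mul, pow_add]
      rfl
    simp only [a] at hstep ⊢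
    rw [e]
    refine (hy _ t).trans (mul_le_mul_of_nonneg_left ?_ hC)
    linarith [hstep t (2 * n)]
  have hsum (t : X) (n : ℕ) : n * a t n ^ 2 ≤ C * (‖y‖ ^ 2 - a t (2 * n)) := by
    have h (m : ℕ) : ∑ k ∈ Finset.range m, a t k ^ 2 ≤ C * (‖y‖ ^ 2 - a t (2 * m)) := by
      induction m with
      | zero =>
        have : a t 0 ≤ ‖y‖ ^ 2 := norm_inner_self_apply_le y t
        simpa using mul_nonneg hC (sub_nonneg.2 this)
      | succ m ih =>
        rw [Finset.sum_range_succ]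
        have h3 : a t (2 * (m + 1)) ≤ a t (2 * m + 1) := hanti t (by omega)
        nlinarith [hsq t m, mul_le_mul_of_nonneg_left h3 hC]
    refine le_trans ?_ (h n)
    have : ∀ k ∈ Finset.range n, a t n ^ 2 ≤ a t k ^ 2 := fun k hk =>
      pow_le_pow_left₀ (norm_nonneg _) (hanti t (Finset.mem_range.1 hk).le) 2
    simpa using Finset.card_nsmul_le_sum _ _ _ this
  have hmem (n : ℕ) : y - r n ∈ Set.range P := by
    induction n with
    | zero => exact ⟨0, by simp [hr0]⟩
    | succ n ih =>
      obtain ⟨z, hz⟩ := ih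
      exact ⟨z + r n, by rw [map_add, hz, hrs]; abel⟩
  have hlim : Tendsto (fun n => y - r n) atTop (𝓝 y) := by
    have h0 : Tendsto r atTop (𝓝 0) := by
      rw [Metric.tendsto_atTop]
      intro ε hε
      obtain ⟨n0, hn0⟩ := exists_nat_gt (C * ‖y‖ ^ 2 / (ε / 2) ^ 4)
      refine ⟨n0 + 1, fun n hn => ?_⟩
      rw [dist_zero_right]
      refine lt_of_le_of_lt (norm_le_of_inner_apply_le (X := X) (half_pos hε).le fun t => ?_)
        (half_lt_self hε)
      by_contra! hlt
      have hlt' : (ε / 2) ^ 2 < a t n := hlt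
      have h5 := hsum t n
      have hn1 : (n0 : ℝ) < n := by exact_mod_cast hn
      rw [div_lt_iff₀ (by positivity)] at hn0
      have h6 : (ε / 2) ^ 4 ≤ a t n ^ 2 := by
        have := pow_le_pow_left₀ (by positivity) hlt'.le 2
        calc (ε / 2) ^ 4 = ((ε / 2) ^ 2) ^ 2 := by ring
          _ ≤ _ := this
      have h7 : (n0 : ℝ) * (ε / 2) ^ 4 ≤ n * a t n ^ 2 := by
        gcongr
      have h8 : 0 ≤ C * a t (2 * n) := mul_nonneg hC (norm_nonneg _)
      nlinarith
    simpa using h0.const_sub y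
  exact mem_closure_of_tendsto hlim (Eventually.of_forall hmem)

end

end IsPos

end Pointwise

/-! ### Unitary polar decomposition relative to a closed set -/

section Polar

section Scaling

variable {E F : Type*} [NormedAddCommGroup E] [NormedSpace ℂ E] [NormedAddCommGroup F]
  [NormedSpace ℂ F]

theorem norm_ofReal_smul_le_one {S : E →L[ℂ] F} {r : ℝ} (hr : 0 < r) (hS : ‖S‖ ≤ r) :
    ‖((r⁻¹ : ℝ) : ℂ) • S‖ ≤ 1 := by
  rw [norm_smul, Complex.norm_real, Real.norm_of_nonneg (inv_nonneg.2 hr.le), inv_mul_le_iff₀ hr,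
    mul_one]
  exact hS

theorem denseRange_smul {S : E →L[ℂ] F} {c : ℂ} (hc : c ≠ 0) (hS : DenseRange S) :
    DenseRange (c • S) := by
  refine hS.mono ?_
  rintro _ ⟨x, rfl⟩
  exact ⟨c⁻¹ • x, by rw [smul_apply, map_smul, smul_inv_smul₀ hc]⟩

end Scaling

variable {X : Type*} [TopologicalSpace X]
variable {M : Type*} [NormedAddCommGroup M] [NormedSpace ℂ M] [SMul C₀(X, ℂ) M]
  [CStarModule C₀(X, ℂ) M]
variable {N : Type*} [NormedAddCommGroup N] [NormedSpace ℂ N] [SMul C₀(X, ℂ) N]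
  [CStarModule C₀(X, ℂ) N]

theorem map_mem_openPart {U : Opens X} {S : M →L[ℂ] N}
    (hS : ∀ (a : C₀(X, ℂ)) x, S (a • x) = a • S x) {m : M} (hm : m ∈ openPart M U) :
    S m ∈ openPart N U := by
  have hcl : IsClosed {m : M | S m ∈ openPart N U} := (isClosed_openPart U).preimage S.continuous
  refine closure_minimal (fun m hm => ?_) hcl hm
  have hle : Submodule.span ℂ {n : M | ∃ a ∈ openIdeal U, ∃ m : M, n = a • m} ≤
      (openPart N U).comap (S : M →ₗ[ℂ] N) := by
    refine Submodule.span_le.2 ?_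
    rintro _ ⟨a, ha, m, rfl⟩
    change S (a • m) ∈ openPart N U
    rw [hS]
    exact act_mem_openPart ha _
  exact hle hm

theorem inner_adjoint_left {S : M → N} {S' : N → M}
    (h : ∀ x y, ⟪S x, y⟫_(C₀(X, ℂ)) = ⟪x, S' y⟫_(C₀(X, ℂ))) (y : N) (x : M) :
    ⟪S' y, x⟫_(C₀(X, ℂ)) = ⟪y, S x⟫_(C₀(X, ℂ)) := by
  rw [← CStarModule.star_inner x (S' y), ← h, CStarModule.star_inner]

theorem sqrtIter_symm {b : M →L[ℂ] M}
    (hb : ∀ x y, ⟪b x, y⟫_(C₀(X, ℂ)) = ⟪x, b y⟫_(C₀(X, ℂ))) (n : ℕ) (x y : M) :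
    ⟪sqrtIter ℂ b n x, y⟫_(C₀(X, ℂ)) = ⟪x, sqrtIter ℂ b n y⟫_(C₀(X, ℂ)) := by
  induction n generalizing x y with
  | zero => simp [sqrtIter]
  | succ n ih => simp [sqrtIter, hb, ih]

theorem sqrtIter_sub_mem {U : Opens X} {b b' : M →L[ℂ] M}
    (hb' : ∀ x y, ⟪b' x, y⟫_(C₀(X, ℂ)) = ⟪x, b' y⟫_(C₀(X, ℂ)))
    (h : ∀ m, b m - b' m ∈ openPart M U) (n : ℕ) (m : M) :
    sqrtIter ℂ b n m - sqrtIter ℂ b' n m ∈ openPart M U := by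
  induction n generalizing m with
  | zero => simp [sqrtIter]
  | succ n ih =>
    have e : sqrtIter ℂ b (n + 1) m - sqrtIter ℂ b' (n + 1) m = (2⁻¹ : ℂ) • ((b m - b' m) +
        ((sqrtIter ℂ b n (sqrtIter ℂ b n m) - sqrtIter ℂ b' n (sqrtIter ℂ b n m)) +
          sqrtIter ℂ b' n (sqrtIter ℂ b n m - sqrtIter ℂ b' n m))) := by
      simp only [sqrtIter, smul_apply, add_apply, mul_apply_eq_comp, map_sub, ← smul_sub]
      congr 1
      abel
    rw [e]
    refine Submodule.smul_mem _ _ (Submodule.add_mem _ (h m) (Submodule.add_mem _ (ih _) ?_))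
    exact map_mem_openPart (map_act_of_adjoint (sqrtIter_symm hb' n)) (ih m)

theorem isPos_adjoint_comp {T : M →L[ℂ] N} {T' : N →L[ℂ] M}
    (h : ∀ x y, ⟪T x, y⟫_(C₀(X, ℂ)) = ⟪x, T' y⟫_(C₀(X, ℂ))) : IsPos (X := X) (T' ∘L T) where
  symm x y := by
    change ⟪T' (T x), y⟫_(C₀(X, ℂ)) = ⟪x, T' (T y)⟫_(C₀(X, ℂ))
    rw [inner_adjoint_left h, h]
  nonneg x := by
    change 0 ≤ ⟪x, T' (T x)⟫_(C₀(X, ℂ))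
    rw [← h]
    exact CStarModule.inner_self_nonneg

theorem IsPos.smul_ofReal {P : M →L[ℂ] M} (hP : IsPos (X := X) P) {c : ℝ} (hc : 0 ≤ c) :
    IsPos (X := X) ((c : ℂ) • P) := by
  refine ⟨fun x y => ?_, fun x => ?_⟩
  · simp only [smul_apply, CStarModule.inner_smul_left_complex,
      CStarModule.inner_smul_right_complex, hP.symm, Complex.star_def, Complex.conj_ofReal]
  · open scoped ComplexOrder in
    intro t
    have := hP.nonneg x t
    simp only [smul_apply, CStarModule.inner_smul_right_complex,
      ZeroAtInftyContinuousMap.smul_apply, smul_eq_mul]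
    exact mul_nonneg (Complex.zero_le_real.2 hc) this

/-- A surjective isometry on a dense subspace extends to an isomorphism of Hilbert modules. -/
theorem exists_iso_of_denseRange [CompleteSpace M] [CompleteSpace N] {Q : M →L[ℂ] M}
    {T : M →L[ℂ] N} (hQ : DenseRange Q) (hT : DenseRange T)
    (hQa : ∀ (a : C₀(X, ℂ)) x, Q (a • x) = a • Q x)
    (hTa : ∀ (a : C₀(X, ℂ)) x, T (a • x) = a • T x)
    (h : ∀ x y, ⟪T x, T y⟫_(C₀(X, ℂ)) = ⟪Q x, Q y⟫_(C₀(X, ℂ))) :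
    ∃ ψ : Iso C₀(X, ℂ) M N, Continuous ψ ∧ ∀ x, ψ (Q x) = T x := by
  have hnorm (x : M) : ‖T x‖ = ‖Q x‖ := by
    rw [CStarModule.norm_eq_sqrt_norm_inner_self (A := C₀(X, ℂ)) (T x), h,
      ← CStarModule.norm_eq_sqrt_norm_inner_self]
  let W : M →L[ℂ] N := (T : M →ₗ[ℂ] N).extendOfNorm (Q : M →ₗ[ℂ] M)
  have hW (x : M) : W (Q x) = T x :=
    LinearMap.extendOfNorm_eq (f := (T : M →ₗ[ℂ] N)) (e := (Q : M →ₗ[ℂ] M)) hQ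
      ⟨1, fun x => by simpa using (hnorm x).le⟩ x
  have hin (x y : M) : ⟪W x, W y⟫_(C₀(X, ℂ)) = ⟪x, y⟫_(C₀(X, ℂ)) := by
    refine hQ.induction_on₂ (p := fun x y => ⟪W x, W y⟫_(C₀(X, ℂ)) = ⟪x, y⟫_(C₀(X, ℂ)))
      ?_ (fun x y => ?_) x y
    · exact isClosed_eq (CStarModule.continuous_inner.comp
        ((W.continuous.comp continuous_fst).prodMk (W.continuous.comp continuous_snd)))
        CStarModule.continuous_inner
    · rw [hW, hW, h]
  have hact (a : C₀(X, ℂ)) (x : M) : W (a • x) = a • W x := by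
    refine hQ.induction_on (p := fun x => W (a • x) = a • W x) x
      (isClosed_eq (W.continuous.comp (continuous_act a))
        ((continuous_act a).comp W.continuous)) fun x => ?_
    rw [← hQa, hW, hTa, hW]
  have hiso : Isometry W := AddMonoidHomClass.isometry_of_norm W fun x => by
    rw [CStarModule.norm_eq_sqrt_norm_inner_self (A := C₀(X, ℂ)) (W x), hin,
      ← CStarModule.norm_eq_sqrt_norm_inner_self]
  have hsurj : Function.Surjective W := by
    rw [← Set.range_eq_univ, ← hiso.isClosedEmbedding.isClosed_range.closure_eq]
    refine DenseRange.closure_range (hT.mono ?_)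
    rintro _ ⟨x, rfl⟩
    exact ⟨Q x, hW x⟩
  exact ⟨{ LinearEquiv.ofBijective (W : M →ₗ[ℂ] N) ⟨hiso.injective, hsurj⟩ with
    map_act' := hact
    map_inner' := hin }, W.continuous, hW⟩

theorem Iso.norm_map {A E F : Type*} [NonUnitalCStarAlgebra A] [PartialOrder A]
    [AddCommGroup E] [Module ℂ E] [SMul A E] [Norm E] [CStarModule A E]
    [AddCommGroup F] [Module ℂ F] [SMul A F] [Norm F] [CStarModule A F]
    (f : Iso A E F) (x : E) : ‖f x‖ = ‖x‖ := by
  rw [CStarModule.norm_eq_sqrt_norm_inner_self (A := A) (f x),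
    CStarModule.norm_eq_sqrt_norm_inner_self (A := A) x]
  exact congrArg (fun a : A => √‖a‖) (f.map_inner' x x)

theorem Iso.continuous {A E F : Type*} [NonUnitalCStarAlgebra A] [PartialOrder A]
    [SeminormedAddCommGroup E] [Module ℂ E] [SMul A E] [CStarModule A E]
    [SeminormedAddCommGroup F] [Module ℂ F] [SMul A F] [CStarModule A F]
    (f : Iso A E F) : Continuous f :=
  (AddMonoidHomClass.isometry_of_norm f.toLinearEquiv f.norm_map).continuous

theorem continuous_toClosed (U : Opens X) : Continuous (toClosed (M := M) U) :=
  continuous_quot_mk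

variable [LocallyCompactSpace X] [T2Space X] [CompleteSpace M] [CompleteSpace N]

theorem exists_iso_of_norm_le_one {U : Opens X}
    (φ : Iso C₀(Compl U, ℂ) (closedPart M U) (closedPart N U))
    {T : M →L[ℂ] N} {T' : N →L[ℂ] M} {θ : M →L[ℂ] M}
    (hadj : ∀ x y, ⟪T x, y⟫_(C₀(X, ℂ)) = ⟪x, T' y⟫_(C₀(X, ℂ))) (hθ : IsPos (X := X) θ)
    (hT : DenseRange T) (hT' : DenseRange T')
    (hK : ∀ m, T' (T m) - θ (θ m) ∈ openPart M U)
    (hφ : ∀ m, toClosed U (T m) = φ (toClosed U (θ m)))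
    (hT1 : ‖T‖ ≤ 1) (hT1' : ‖T'‖ ≤ 1) (hθ1 : ‖θ‖ ≤ 1) :
    ∃ ψ : Iso C₀(X, ℂ) M N, ∀ m, toClosed U (ψ m) = φ (toClosed U m) := by
  have hKpos := isPos_adjoint_comp hadj
  have hK1 : ‖T' ∘L T‖ ≤ 1 :=
    (ContinuousLinearMap.opNorm_comp_le _ _).trans (mul_le_one₀ hT1' (norm_nonneg _) hT1)
  have hθθ : IsPos (X := X) (θ ∘L θ) := isPos_adjoint_comp hθ.symm
  have hθθ1 : ‖θ ∘L θ‖ ≤ 1 :=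
    (ContinuousLinearMap.opNorm_comp_le _ _).trans (mul_le_one₀ hθ1 (norm_nonneg _) hθ1)
  obtain ⟨y, hy, hyy⟩ := exists_tendsto_sqrtIter (𝕜 := ℂ) (hKpos.norm_one_sub_le hK1)
  have hz : Tendsto (sqrtIter ℂ (1 - θ ∘L θ)) atTop (𝓝 (1 - θ)) := by
    refine tendsto_sqrtIter_of_norm_le (hθθ.norm_one_sub_le hθθ1) (hθ.norm_one_sub_le hθ1) ?_
    rw [sub_sub_cancel, sub_sub_cancel]
    rfl
  have hsymm1 {P : M →L[ℂ] M} (hP : IsPos (X := X) P) (x z : M) :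
      ⟪(1 - P) x, z⟫_(C₀(X, ℂ)) = ⟪x, (1 - P) z⟫_(C₀(X, ℂ)) := by
    change ⟪x - P x, z⟫_(C₀(X, ℂ)) = ⟪x, z - P z⟫_(C₀(X, ℂ))
    simp [hP.symm]
  have happ {u : ℕ → M →L[ℂ] M} {v : M →L[ℂ] M} (h : Tendsto u atTop (𝓝 v)) (m : M) :
      Tendsto (fun n => u n m) atTop (𝓝 (v m)) :=
    ((ContinuousLinearMap.apply ℂ M m).continuous.tendsto v).comp h
  set Q : M →L[ℂ] M := 1 - y with hQdef
  have hQQ (x : M) : Q (Q x) = T' (T x) := by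
    have : Q * Q = T' ∘L T := by rw [hyy, sub_sub_cancel]
    exact DFunLike.congr_fun this x
  have hysymm (x z : M) : ⟪y x, z⟫_(C₀(X, ℂ)) = ⟪x, y z⟫_(C₀(X, ℂ)) := by
    have h1 : Tendsto (fun n => ⟪sqrtIter ℂ (1 - T' ∘L T) n x, z⟫_(C₀(X, ℂ))) atTop
        (𝓝 ⟪y x, z⟫_(C₀(X, ℂ))) :=
      (CStarModule.continuous_inner.tendsto (y x, z)).comp
        ((happ hy x).prodMk_nhds tendsto_const_nhds)
    have h2 : Tendsto (fun n => ⟪x, sqrtIter ℂ (1 - T' ∘L T) n z⟫_(C₀(X, ℂ))) atTop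
        (𝓝 ⟪x, y z⟫_(C₀(X, ℂ))) :=
      (CStarModule.continuous_inner.tendsto (x, y z)).comp
        (tendsto_const_nhds.prodMk_nhds (happ hy z))
    refine tendsto_nhds_unique h1 (h2.congr fun n => ?_)
    exact (sqrtIter_symm (hsymm1 hKpos) n x z).symm
  have hQsymm (x z : M) : ⟪Q x, z⟫_(C₀(X, ℂ)) = ⟪x, Q z⟫_(C₀(X, ℂ)) := by
    change ⟪x - y x, z⟫_(C₀(X, ℂ)) = ⟪x, z - y z⟫_(C₀(X, ℂ))
    simp [hysymm]
  have hQθ (m : M) : Q m - θ m ∈ openPart M U := by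
    have h1 : (1 - θ) m - y m ∈ openPart M U := by
      refine (isClosed_openPart U).mem_of_tendsto ((happ hz m).sub (happ hy m))
        (Eventually.of_forall fun n => ?_)
      rw [← neg_sub]
      refine Submodule.neg_mem _ (sqrtIter_sub_mem (hsymm1 hθθ) (fun m => ?_) n m)
      change m - T' (T m) - (m - θ (θ m)) ∈ openPart M U
      rw [sub_sub_sub_cancel_left, ← neg_sub]
      exact Submodule.neg_mem _ (hK m)
    convert h1 using 1
    change m - y m - θ m = m - θ m - y m
    abel
  have hQd : DenseRange Q := by
    refine (hT'.comp hT T'.continuous).mono ?_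
    rintro _ ⟨x, rfl⟩
    exact ⟨Q x, hQQ x⟩
  obtain ⟨ψ, hψ, hψQ⟩ := exists_iso_of_denseRange hQd hT (map_act_of_adjoint hQsymm)
    (map_act_of_adjoint hadj) fun x z => by rw [hadj, hQsymm, hQQ]
  refine ⟨ψ, fun m => ?_⟩
  refine hQd.induction_on (p := fun m => toClosed U (ψ m) = φ (toClosed U m)) m
    (isClosed_eq ((continuous_toClosed U).comp hψ) (φ.continuous.comp (continuous_toClosed U)))
    fun x => ?_
  rw [hψQ, hφ]
  congr 1
  rw [← sub_eq_zero, ← map_sub, toClosed_eq_zero, ← neg_sub]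
  exact Submodule.neg_mem _ (hQθ x)

theorem exists_iso_of_adjoint {U : Opens X}
    (φ : Iso C₀(Compl U, ℂ) (closedPart M U) (closedPart N U))
    {T : M →L[ℂ] N} {T' : N →L[ℂ] M} {θ : M →L[ℂ] M}
    (hadj : ∀ x y, ⟪T x, y⟫_(C₀(X, ℂ)) = ⟪x, T' y⟫_(C₀(X, ℂ))) (hθ : IsPos (X := X) θ)
    (hT : DenseRange T) (hT' : DenseRange T')
    (hK : ∀ m, T' (T m) - θ (θ m) ∈ openPart M U)
    (hφ : ∀ m, toClosed U (T m) = φ (toClosed U (θ m))) :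
    ∃ ψ : Iso C₀(X, ℂ) M N, ∀ m, toClosed U (ψ m) = φ (toClosed U m) := by
  set c : ℝ := (1 + ‖T‖ + ‖T'‖ + ‖θ‖)⁻¹ with hc
  have hpos : 0 < 1 + ‖T‖ + ‖T'‖ + ‖θ‖ := by positivity
  have hc0 : 0 < c := inv_pos.2 hpos
  have hcC : (c : ℂ) ≠ 0 := Complex.ofReal_ne_zero.2 hc0.ne'
  have hstar : star (c : ℂ) = c := Complex.conj_ofReal c
  have h1 := norm_nonneg T
  have h2 := norm_nonneg T'
  have h3 := norm_nonneg θ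
  have hT1 : ‖(c : ℂ) • T‖ ≤ 1 := norm_ofReal_smul_le_one hpos (by linarith)
  have hT1' : ‖(c : ℂ) • T'‖ ≤ 1 := norm_ofReal_smul_le_one hpos (by linarith)
  have hθ1 : ‖(c : ℂ) • θ‖ ≤ 1 := norm_ofReal_smul_le_one hpos (by linarith)
  have hadj1 (x : M) (y : N) :
      ⟪((c : ℂ) • T) x, y⟫_(C₀(X, ℂ)) = ⟪x, ((c : ℂ) • T') y⟫_(C₀(X, ℂ)) := by
    simp only [smul_apply, CStarModule.inner_smul_left_complex,
      CStarModule.inner_smul_right_complex, hadj, hstar]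
  have hpos1 : IsPos (X := X) ((c : ℂ) • θ) :=
    hθ.smul_ofReal hc0.le
  have hK1 (m : M) : ((c : ℂ) • T') (((c : ℂ) • T) m) - ((c : ℂ) • θ) (((c : ℂ) • θ) m) ∈
      openPart M U := by
    have : ((c : ℂ) • T') (((c : ℂ) • T) m) - ((c : ℂ) • θ) (((c : ℂ) • θ) m) =
        (c : ℂ) • (c : ℂ) • (T' (T m) - θ (θ m)) := by
      simp only [smul_apply, map_smul, smul_sub]
    rw [this]
    exact Submodule.smul_mem _ _ (Submodule.smul_mem _ _ (hK m))
  have hφ1 (m : M) : toClosed U (((c : ℂ) • T) m) = φ (toClosed U (((c : ℂ) • θ) m)) := by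
    simp only [smul_apply, map_smul, hφ]
  exact exists_iso_of_norm_le_one φ hadj1 hpos1 (denseRange_smul hcC hT) (denseRange_smul hcC hT')
    hK1 hφ1 hT1 hT1' hθ1

end Polar

/-! ### Nuclear operators -/

section Nuclear

variable {X : Type*} [TopologicalSpace X]
variable {M : Type*} [NormedAddCommGroup M] [NormedSpace ℂ M] [SMul C₀(X, ℂ) M]
  [CStarModule C₀(X, ℂ) M]
variable {N : Type*} [NormedAddCommGroup N] [NormedSpace ℂ N] [SMul C₀(X, ℂ) N]
  [CStarModule C₀(X, ℂ) N]

theorem smul_act (c : ℂ) (a : C₀(X, ℂ)) (x : M) : (c • a) • x = c • (a • x) :=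
  ext_inner (A := C₀(X, ℂ)) fun z => by
    simp only [CStarModule.inner_op_smul_right, CStarModule.inner_smul_right_complex,
      smul_mul_assoc]

theorem act_comm (a b : C₀(X, ℂ)) (x : M) : a • (b • x) = b • (a • x) := by
  rw [← mul_act, ← mul_act, mul_comm]

theorem continuous_act_left (x : M) : Continuous fun a : C₀(X, ℂ) => a • x := by
  let f : C₀(X, ℂ) →ₗ[ℂ] M :=
    { toFun := fun a => a • x
      map_add' := fun a b => add_act a b x
      map_smul' := fun c a => smul_act c a x }
  exact AddMonoidHomClass.continuous_of_bound f ‖x‖ fun a => by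
    rw [mul_comm]
    exact norm_act_le a x

/-- The operator `x ↦ ⟨m, x⟩ n`. -/
def rankOne (n : N) (m : M) : M →L[ℂ] N :=
  LinearMap.mkContinuous
    { toFun := fun x => ⟪m, x⟫_(C₀(X, ℂ)) • n
      map_add' := fun x y => by rw [CStarModule.inner_add_right, add_act]
      map_smul' := fun c x => by
        rw [CStarModule.inner_smul_right_complex, smul_act, RingHom.id_apply] }
    (‖m‖ * ‖n‖) fun x => by
      refine (norm_act_le _ _).trans ?_
      have := CStarModule.norm_inner_le (A := C₀(X, ℂ)) M (x := m) (y := x)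
      calc ‖⟪m, x⟫_(C₀(X, ℂ))‖ * ‖n‖ ≤ ‖m‖ * ‖x‖ * ‖n‖ := by gcongr
        _ = ‖m‖ * ‖n‖ * ‖x‖ := by ring

variable (X) in
/-- The nuclear operator `x ↦ ∑ ⟨mᵢ, x⟩ nᵢ`. -/
def nuc (n : ℕ → N) (m : ℕ → M) : M →L[ℂ] N := ∑' i, rankOne (X := X) (n i) (m i)

theorem hasSum_nuc [CompleteSpace N] {n : ℕ → N} {m : ℕ → M}
    (h : Summable fun i => ‖m i‖ * ‖n i‖) (x : M) :
    HasSum (fun i => ⟪m i, x⟫_(C₀(X, ℂ)) • n i) (nuc X n m x) := by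
  have hs : Summable fun i => rankOne (X := X) (n i) (m i) :=
    Summable.of_norm_bounded h fun i => LinearMap.mkContinuous_norm_le _ (by positivity) _
  exact hs.hasSum.map (ContinuousLinearMap.apply ℂ N x) (ContinuousLinearMap.apply ℂ N x).continuous

theorem HasSum.inner_right {f : ℕ → M} {s : M} (h : HasSum f s) (x : M) :
    HasSum (fun i => ⟪x, f i⟫_(C₀(X, ℂ))) ⟪x, s⟫_(C₀(X, ℂ)) :=
  h.map (CStarModule.innerSL (A := C₀(X, ℂ)) x) (CStarModule.innerSL (A := C₀(X, ℂ)) x).continuous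

theorem HasSum.inner_left {f : ℕ → M} {s : M} (h : HasSum f s) (x : M) :
    HasSum (fun i => ⟪f i, x⟫_(C₀(X, ℂ))) ⟪s, x⟫_(C₀(X, ℂ)) := by
  have := (HasSum.inner_right (X := X) h x).star
  simpa only [CStarModule.star_inner] using this

theorem inner_nuc [CompleteSpace M] [CompleteSpace N] {n : ℕ → N} {m : ℕ → M}
    (h : Summable fun i => ‖m i‖ * ‖n i‖) (x : M) (y : N) :
    ⟪nuc X n m x, y⟫_(C₀(X, ℂ)) = ⟪x, nuc X m n y⟫_(C₀(X, ℂ)) := by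
  have h' : Summable fun i => ‖n i‖ * ‖m i‖ := by simpa only [mul_comm] using h
  have h1 := HasSum.inner_left (X := X) (hasSum_nuc (X := X) h x) y
  have h2 := HasSum.inner_right (X := X) (hasSum_nuc (X := X) h' y) x
  refine h1.unique ?_
  convert h2 using 2 with i
  rw [CStarModule.inner_op_smul_left, CStarModule.inner_op_smul_right, CStarModule.star_inner]

open scoped ComplexOrder in
theorem isPos_nuc [CompleteSpace M] {m : ℕ → M} (h : Summable fun i => ‖m i‖ * ‖m i‖) :
    IsPos (X := X) (nuc X m m) where
  symm := inner_nuc h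
  nonneg x t := by
    have h1 := (HasSum.inner_right (X := X) (hasSum_nuc (X := X) h x) x).map (evalHom t)
      (continuous_evalHom t)
    refine h1.nonneg fun i => ?_
    change (0 : ℂ) ≤ (⟪x, ⟪m i, x⟫_(C₀(X, ℂ)) • m i⟫_(C₀(X, ℂ))) t
    rw [CStarModule.inner_op_smul_right, ← CStarModule.star_inner (m i) x,
      ZeroAtInftyContinuousMap.mul_apply, ZeroAtInftyContinuousMap.star_apply]
    exact mul_star_self_nonneg _

theorem norm_inner_sq_le_nuc [CompleteSpace M] {m : ℕ → M} (h : Summable fun i => ‖m i‖ * ‖m i‖)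
    (j : ℕ) (x : M) (t : X) :
    ‖(⟪m j, x⟫_(C₀(X, ℂ))) t‖ ^ 2 ≤ ‖(⟪x, nuc X m m x⟫_(C₀(X, ℂ))) t‖ := by
  have h1 := (HasSum.inner_right (X := X) (hasSum_nuc (X := X) h x) x).map (evalHom t)
    (continuous_evalHom t)
  have e : ((evalHom t : C₀(X, ℂ) → ℂ) ∘ fun i => ⟪x, ⟪m i, x⟫_(C₀(X, ℂ)) • m i⟫_(C₀(X, ℂ))) =
      fun i => ((‖(⟪m i, x⟫_(C₀(X, ℂ))) t‖ ^ 2 : ℝ) : ℂ) := by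
    funext i
    change (⟪x, ⟪m i, x⟫_(C₀(X, ℂ)) • m i⟫_(C₀(X, ℂ))) t = _
    rw [CStarModule.inner_op_smul_right, ← CStarModule.star_inner (m i) x,
      ZeroAtInftyContinuousMap.mul_apply, ZeroAtInftyContinuousMap.star_apply, Complex.star_def,
      Complex.mul_conj']
    push_cast
    rfl
  rw [e] at h1
  have h2 := Complex.reCLM.hasSum h1
  have h3 := le_hasSum h2 j fun i _ => by
    change 0 ≤ ((‖(⟪m i, x⟫_(C₀(X, ℂ))) t‖ ^ 2 : ℝ) : ℂ).re
    rw [Complex.ofReal_re]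
    positivity
  exact h3.trans (Complex.re_le_norm _)

theorem nuc_smul_comm (w : ℕ → ℝ) (n : ℕ → N) (m : ℕ → M) :
    nuc X n (fun i => (w i : ℂ) • m i) = nuc X (fun i => (w i : ℂ) • n i) m := by
  unfold nuc
  congr 1
  funext i
  ext x
  change ⟪(w i : ℂ) • m i, x⟫_(C₀(X, ℂ)) • n i = ⟪m i, x⟫_(C₀(X, ℂ)) • ((w i : ℂ) • n i)
  rw [CStarModule.inner_smul_left_complex, smul_act, act_smul, Complex.star_def, Complex.conj_ofReal]

theorem hasSum_mem {R : Submodule ℂ M} (hR : IsClosed (R : Set M)) {f : ℕ → M} {s : M}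
    (h : HasSum f s) (hf : ∀ i, f i ∈ R) : s ∈ R :=
  hR.mem_of_tendsto h (Eventually.of_forall fun _ => Submodule.sum_mem _ fun i _ => hf i)

theorem nuc_mem_openPart [CompleteSpace N] {U : Opens X} {n : ℕ → N} {m : ℕ → M}
    (h : Summable fun i => ‖m i‖ * ‖n i‖) (hn : ∀ i, n i ∈ openPart N U) (x : M) :
    nuc X n m x ∈ openPart N U :=
  hasSum_mem (isClosed_openPart U) (hasSum_nuc h x) fun i => act_mem_of_mem _ (hn i)

theorem tendsto_nuc_zero [CompleteSpace N] {n : ℕ → N} {m : ℕ → M}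
    (h : Summable fun i => ‖m i‖ * ‖n i‖) {e : ℕ → M} {C : ℝ} (hC : ∀ k, ‖e k‖ ≤ C)
    (he : ∀ x : M, Tendsto (fun k => ⟪x, e k⟫_(C₀(X, ℂ))) atTop (𝓝 0)) :
    Tendsto (fun k => nuc X n m (e k)) atTop (𝓝 0) := by
  have h1 : Tendsto (fun k => ∑' i, ⟪m i, e k⟫_(C₀(X, ℂ)) • n i) atTop (𝓝 (∑' _ : ℕ, (0 : N))) := by
    refine tendsto_tsum_of_dominated_convergence (bound := fun i => ‖m i‖ * ‖n i‖ * C)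
      (h.mul_right C) (fun i => ?_) (Eventually.of_forall fun k i => ?_)
    · have := ((continuous_act_left (n i)).tendsto (0 : C₀(X, ℂ))).comp (he (m i))
      have h0 : (0 : C₀(X, ℂ)) • n i = 0 := by
        rw [← sub_self (0 : C₀(X, ℂ)), sub_act, sub_self]
      rwa [h0] at this
    · refine (norm_act_le _ _).trans ?_
      have := CStarModule.norm_inner_le (A := C₀(X, ℂ)) M (x := m i) (y := e k)
      calc ‖⟪m i, e k⟫_(C₀(X, ℂ))‖ * ‖n i‖ ≤ ‖m i‖ * ‖e k‖ * ‖n i‖ := by gcongr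
        _ ≤ ‖m i‖ * C * ‖n i‖ := by gcongr; exact hC k
        _ = ‖m i‖ * ‖n i‖ * C := by ring
  rw [tsum_zero] at h1
  exact h1.congr fun k => (hasSum_nuc h (e k)).tsum_eq

theorem hasSum_of_forall_eq {ι E : Type*} [AddCommMonoid E] [TopologicalSpace E] {f g : ι → E}
    {s : E} (hg : HasSum g s) (h : ∀ i, f i = g i) : HasSum f s :=
  (funext h : f = g) ▸ hg

section Quotient

variable [LocallyCompactSpace X] [T2Space X] [CompleteSpace M] [CompleteSpace N] {U : Opens X}
variable (φ : Iso C₀(Compl U, ℂ) (closedPart M U) (closedPart N U)) {n : ℕ → N} {m : ℕ → M}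

include φ

theorem toClosed_nuc (hφ : ∀ i, φ (toClosed U (m i)) = toClosed U (n i))
    (h : Summable fun i => ‖m i‖ * ‖n i‖) (h' : Summable fun i => ‖m i‖ * ‖m i‖) (x : M) :
    toClosed U (nuc X n m x) = φ (toClosed U (nuc X m m x)) := by
  have h1 := (hasSum_nuc (X := X) h x).map (toClosed U) (continuous_toClosed U)
  have h2 := ((hasSum_nuc (X := X) h' x).map (toClosed U) (continuous_toClosed U)).map
    φ.toLinearEquiv φ.continuous
  refine h1.unique (hasSum_of_forall_eq h2 fun i => ?_)
  change toClosed U (⟪m i, x⟫_(C₀(X, ℂ)) • n i) = φ (toClosed U (⟪m i, x⟫_(C₀(X, ℂ)) • m i))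
  rw [← res_act_toClosed, ← res_act_toClosed, ← hφ]
  exact (φ.map_act' _ _).symm

theorem toClosed_nuc_adjoint (hφ : ∀ i, φ (toClosed U (m i)) = toClosed U (n i))
    (h : Summable fun i => ‖n i‖ * ‖m i‖) (h' : Summable fun i => ‖m i‖ * ‖m i‖) {x : M} {y : N}
    (hxy : toClosed U y = φ (toClosed U x)) :
    toClosed U (nuc X m n y) = toClosed U (nuc X m m x) := by
  have h1 := (hasSum_nuc (X := X) h y).map (toClosed U) (continuous_toClosed U)
  have h2 := (hasSum_nuc (X := X) h' x).map (toClosed U) (continuous_toClosed U)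
  refine h1.unique (hasSum_of_forall_eq h2 fun i => ?_)
  change toClosed U (⟪n i, y⟫_(C₀(X, ℂ)) • m i) = toClosed U (⟪m i, x⟫_(C₀(X, ℂ)) • m i)
  rw [← res_act_toClosed, ← res_act_toClosed, ← inner_toClosed, ← inner_toClosed, ← hφ, hxy]
  congr 1
  exact φ.map_inner' _ _

end Quotient

end Nuclear

/-! ### Functions in `C₀(X)` and their zero sets -/

section Functions

variable {X : Type*} [TopologicalSpace X]

theorem norm_star_mul_self (f : C₀(X, ℂ)) : ‖star f * f‖ = ‖f‖ * ‖f‖ :=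
  CStarRing.norm_star_mul_self

/-- If `d` vanishes wherever `g` does, then `d` is a limit of multiples of `g`. -/
theorem mem_closure_range_mul {d g : C₀(X, ℂ)} (h : ∀ t, g t = 0 → d t = 0) :
    d ∈ closure (Set.range fun a : C₀(X, ℂ) => a * g) := by
  rw [Metric.mem_closure_range_iff]
  intro δ hδ
  obtain ⟨c, hc, hcg⟩ : ∃ c > 0, ∀ t, δ / 2 ≤ ‖d t‖ → c ≤ ‖g t‖ ^ 2 := by
    have hK : IsCompact {t | δ / 2 ≤ ‖d t‖} := by
      have h0 : Tendsto (fun t => ‖d t‖) (cocompact X) (𝓝 0) := by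
        simpa using (zero_at_infty d).norm
      have h1 := h0.eventually_lt_const (half_pos hδ)
      obtain ⟨K, hK, hKs⟩ := mem_cocompact.1 h1
      refine hK.of_isClosed_subset (isClosed_le continuous_const (map_continuous d).norm) ?_
      intro t ht
      by_contra htK
      have h2 : ‖d t‖ < δ / 2 := hKs htK
      exact absurd h2 (not_lt.2 ht)
    rcases Set.eq_empty_or_nonempty {t | δ / 2 ≤ ‖d t‖} with he | hne
    · refine ⟨1, one_pos, fun t ht => ?_⟩
      exact absurd ht (Set.eq_empty_iff_forall_notMem.1 he t)
    · obtain ⟨t0, ht0, hmin⟩ := hK.exists_isMinOn hne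
        (f := fun t => ‖g t‖ ^ 2) ((map_continuous g).norm.pow 2).continuousOn
      refine ⟨‖g t0‖ ^ 2, ?_, fun t ht => hmin ht⟩
      have : g t0 ≠ 0 := fun hg => by
        have h1 : δ / 2 ≤ ‖d t0‖ := ht0
        rw [h t0 hg, norm_zero] at h1
        linarith
      positivity
  obtain ⟨ε, hε, hεc⟩ : ∃ ε > 0, ‖d‖ * ε ≤ δ / 2 * c := by
    refine ⟨δ / 2 * c / (‖d‖ + 1), by positivity, ?_⟩
    rw [mul_div_assoc', div_le_iff₀ (by positivity)]
    have : 0 ≤ δ / 2 * c := by positivity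
    nlinarith [norm_nonneg d]
  have hpos (t : X) : 0 < ‖g t‖ ^ 2 + ε := by positivity
  have hposC (t : X) : ((‖g t‖ ^ 2 + ε : ℝ) : ℂ) ≠ 0 := Complex.ofReal_ne_zero.2 (hpos t).ne'
  let r : X → ℂ := fun t => d t * star (g t) / ((‖g t‖ ^ 2 + ε : ℝ) : ℂ)
  have hr : Continuous r := by
    refine Continuous.div ((map_continuous d).mul (map_continuous g).star)
      (Complex.continuous_ofReal.comp (((map_continuous g).norm.pow 2).add continuous_const)) hposC
  have hr0 : Tendsto r (cocompact X) (𝓝 0) := by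
    have h0 : Tendsto (fun t => ‖d t‖ * (‖g‖ / ε)) (cocompact X) (𝓝 0) := by
      simpa using (zero_at_infty d).norm.mul_const (‖g‖ / ε)
    refine squeeze_zero_norm (fun t => ?_) h0
    simp only [r]
    rw [norm_div, norm_mul, norm_star, Complex.norm_real, Real.norm_of_nonneg (hpos t).le,
      mul_div_assoc]
    gcongr
    · exact norm_apply_le g t
    · linarith [sq_nonneg ‖g t‖]
  refine ⟨⟨⟨r, hr⟩, hr0⟩, ?_⟩
  rw [dist_eq_norm]
  refine lt_of_le_of_lt (norm_le_of (half_pos hδ).le fun t => ?_) (half_lt_self hδ)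
  have e : (d - (⟨⟨r, hr⟩, hr0⟩ : C₀(X, ℂ)) * g) t =
      d t * ((ε / (‖g t‖ ^ 2 + ε) : ℝ) : ℂ) := by
    change d t - d t * star (g t) / ((‖g t‖ ^ 2 + ε : ℝ) : ℂ) * g t = _
    have h1 : star (g t) * g t = ((‖g t‖ ^ 2 : ℝ) : ℂ) := by
      rw [Complex.star_def, Complex.conj_mul']
      push_cast
      rfl
    have h2 := hposC t
    rw [Complex.ofReal_div]
    field_simp
    rw [mul_sub, h1]
    push_cast
    ring
  rw [e, norm_mul, Complex.norm_real, Real.norm_of_nonneg (div_nonneg hε.le (hpos t).le)]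
  by_cases ht : δ / 2 ≤ ‖d t‖
  · have h1 := hcg t ht
    rw [mul_div_assoc', div_le_iff₀ (hpos t)]
    calc ‖d t‖ * ε ≤ ‖d‖ * ε := by gcongr; exact norm_apply_le d t
      _ ≤ δ / 2 * c := hεc
      _ ≤ δ / 2 * (‖g t‖ ^ 2 + ε) := by gcongr; linarith
  · push Not at ht
    have h1 : ε / (‖g t‖ ^ 2 + ε) ≤ 1 := by
      rw [div_le_one (hpos t)]
      linarith [sq_nonneg ‖g t‖]
    calc ‖d t‖ * (ε / (‖g t‖ ^ 2 + ε)) ≤ ‖d t‖ * 1 := by gcongr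
      _ ≤ δ / 2 := by linarith

/-- Countably many functions in `C₀(U)` vanish on the zero set of a single one. -/
theorem exists_mem_openIdeal {U : Opens X} {d : ℕ → C₀(X, ℂ)} (hd : ∀ k, d k ∈ openIdeal U) :
    ∃ h ∈ openIdeal U, ∀ t, h t = 0 → ∀ k, d k t = 0 := by
  let c : ℕ → ℝ := fun k => (1 / 2 : ℝ) ^ k / (1 + ‖d k‖ * ‖d k‖)
  have hc (k : ℕ) : 0 < c k := by positivity
  have hs : Summable fun k => (c k : ℂ) • (star (d k) * d k) := by
    refine Summable.of_norm_bounded summable_geometric_two fun k => ?_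
    rw [norm_smul, Complex.norm_real, Real.norm_of_nonneg (hc k).le, norm_star_mul_self,
      div_mul_eq_mul_div, div_le_iff₀ (by positivity)]
    gcongr
    linarith
  have hsum (t : X) : HasSum (fun k => ((c k * ‖d k t‖ ^ 2 : ℝ) : ℂ))
      ((∑' k, (c k : ℂ) • (star (d k) * d k) : C₀(X, ℂ)) t) := by
    have h1 := hs.hasSum.map (evalHom t) (continuous_evalHom t)
    have e : (fun k => ((c k * ‖d k t‖ ^ 2 : ℝ) : ℂ)) =
        (evalHom t : C₀(X, ℂ) → ℂ) ∘ fun k => (c k : ℂ) • (star (d k) * d k) := funext fun k => ?_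
    · rw [e]
      exact h1
    change _ = (c k : ℂ) * (star (d k t) * d k t)
    rw [Complex.star_def, Complex.conj_mul']
    push_cast
    rfl
  refine ⟨∑' k, (c k : ℂ) • (star (d k) * d k), fun t ht => ?_, fun t ht k => ?_⟩
  · refine (hsum t).unique ?_
    have : (fun k => ((c k * ‖d k t‖ ^ 2 : ℝ) : ℂ)) = fun _ => 0 := by
      funext k
      simp [hd k t ht]
    rw [this]
    exact hasSum_zero
  · have h1 := hsum t
    rw [ht] at h1
    have h2 : HasSum (fun k => c k * ‖d k t‖ ^ 2) 0 := by
      rw [← Complex.hasSum_ofReal]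
      simpa using h1
    have h3 := (hasSum_zero_iff_of_nonneg
      (fun k => mul_nonneg (hc k).le (sq_nonneg ‖d k t‖))).1 h2
    have h4 : c k * ‖d k t‖ ^ 2 = 0 := congrFun h3 k
    simpa [(hc k).ne'] using h4

end Functions

/-! ### Orthogonal sequences coming from `ℓ₂(U)` -/

section Frame

variable {X : Type*} [TopologicalSpace X]

namespace ellTwo

variable {U : Opens X}

theorem inner_def (x y : ellTwo U) : ⟪x, y⟫_(C₀(X, ℂ)) = ∑' i, star (x.1 i) * y.1 i := rfl

/-- The sequence with a single nonzero entry. -/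
def single (k : ℕ) (f : C₀(X, ℂ)) (hf : f ∈ openIdeal U) : ellTwo U :=
  ⟨Pi.single k f, fun i => by
    by_cases h : i = k
    · subst h
      simpa using hf
    · simp [h], by
    refine summable_of_ne_finset_zero (s := {k}) fun i hi => ?_
    have : i ≠ k := by simpa using hi
    simp [this]⟩

theorem inner_single_right (x : ellTwo U) (k : ℕ) {f : C₀(X, ℂ)} (hf : f ∈ openIdeal U) :
    ⟪x, single k f hf⟫_(C₀(X, ℂ)) = star (x.1 k) * f := by
  refine (ellTwo.hasSum_inner x _).unique ?_
  have := hasSum_single (f := fun i => star (x.1 i) * (single k f hf).1 i) k fun i hi => by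
    simp [single, hi]
  simpa [single] using this

theorem act_single (a : C₀(X, ℂ)) (k : ℕ) {f : C₀(X, ℂ)} (hf : f ∈ openIdeal U)
    (haf : a * f ∈ openIdeal U) : a • single k f hf = single k (a * f) haf := by
  ext i : 2
  change a * (Pi.single k f : ℕ → C₀(X, ℂ)) i = (Pi.single k (a * f) : ℕ → C₀(X, ℂ)) i
  by_cases h : i = k
  · subst h
    simp
  · simp [h]

theorem tendsto_norm_sub_sum_single (x : ellTwo U) :
    Tendsto (fun K => ‖x - ∑ k ∈ Finset.range K, single k (x.1 k) (x.2.1 k)‖) atTop (𝓝 0) := by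
  have hcoord (K i : ℕ) : (∑ k ∈ Finset.range K, single k (x.1 k) (x.2.1 k) : ellTwo U).1 i =
      if i < K then x.1 i else 0 := by
    rw [Submodule.coe_sum, Finset.sum_apply]
    simp only [single, Pi.single_apply]
    simp
  have hin (K : ℕ) : ⟪x - ∑ k ∈ Finset.range K, single k (x.1 k) (x.2.1 k),
      x - ∑ k ∈ Finset.range K, single k (x.1 k) (x.2.1 k)⟫_(C₀(X, ℂ)) =
      ∑' i, star (x.1 (i + K)) * x.1 (i + K) := by
    have hs := summable_inner (x - ∑ k ∈ Finset.range K, single k (x.1 k) (x.2.1 k))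
      (x - ∑ k ∈ Finset.range K, single k (x.1 k) (x.2.1 k))
    rw [inner_def, ← hs.sum_add_tsum_nat_add K]
    have h0 : ∀ i, (x - ∑ k ∈ Finset.range K, single k (x.1 k) (x.2.1 k)).1 i =
        if i < K then 0 else x.1 i := fun i => by
      rw [Submodule.coe_sub, Pi.sub_apply, hcoord]
      split_ifs <;> simp
    simp only [h0]
    rw [Finset.sum_eq_zero fun i hi => by simp [Finset.mem_range.1 hi], zero_add]
    simp
  have hlim := tendsto_sum_nat_add (fun i => star (x.1 i) * x.1 i)
  have h2 := (Real.continuous_sqrt.tendsto 0).comp (hlim.norm.trans (by rw [norm_zero]))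
  rw [Real.sqrt_zero] at h2
  refine h2.congr fun K => ?_
  change _ = √‖⟪x - ∑ k ∈ Finset.range K, single k (x.1 k) (x.2.1 k),
      x - ∑ k ∈ Finset.range K, single k (x.1 k) (x.2.1 k)⟫_(C₀(X, ℂ))‖
  rw [hin]
  rfl

theorem tendsto_coord (x : ellTwo U) : Tendsto x.1 atTop (𝓝 0) := by
  have h := x.2.2.tendsto_atTop_zero.norm
  simp only [norm_star_mul_self, norm_zero] at h
  rw [tendsto_zero_iff_norm_tendsto_zero]
  have h2 := (Real.continuous_sqrt.tendsto 0).comp h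
  rw [Real.sqrt_zero] at h2
  exact h2.congr fun k => Real.sqrt_mul_self (norm_nonneg _)

end ellTwo

variable {M : Type*} [NormedAddCommGroup M] [NormedSpace ℂ M] [SMul C₀(X, ℂ) M]
  [CStarModule C₀(X, ℂ) M]

/-- A sequence in `M|_U` that behaves like the multiples by `g = h⋆ h` of an orthonormal basis. -/
structure IsFrame (U : Opens X) (h : C₀(X, ℂ)) (e : ℕ → M) : Prop where
  mem : ∀ k, e k ∈ openPart M U
  inner_self : ∀ k, ⟪e k, e k⟫_(C₀(X, ℂ)) = star h * h * (star h * h)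
  inner_of_ne : ∀ k l, k ≠ l → ⟪e k, e l⟫_(C₀(X, ℂ)) = 0
  tendsto : ∀ m : M, Tendsto (fun k => ⟪m, e k⟫_(C₀(X, ℂ))) atTop (𝓝 0)
  eq_act : ∀ k, ∃ u, e k = h • u
  mem_closure : ∀ m : M, (star h * h * (star h * h)) • m ∈
    (Submodule.span ℂ {n : M | ∃ (a : C₀(X, ℂ)) (k : ℕ), n = a • e k}).topologicalClosure

theorem exists_isFrame {U : Opens X} {h : C₀(X, ℂ)} (hh : h ∈ openIdeal U)
    (f : Iso C₀(X, ℂ) (openPart M U) (ellTwo U)) : ∃ e : ℕ → M, IsFrame U h e := by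
  let α : ellTwo U →ₗ[ℂ] openPart M U := f.toLinearEquiv.symm.toLinearMap
  have hfα (x : ellTwo U) : f (α x) = x := f.toLinearEquiv.apply_symm_apply x
  have hαf (x : openPart M U) : α (f x) = x := f.toLinearEquiv.symm_apply_apply x
  have hα (x y : ellTwo U) :
      ⟪((α x : openPart M U) : M), ((α y : openPart M U) : M)⟫_(C₀(X, ℂ)) = ⟪x, y⟫_(C₀(X, ℂ)) := by
    have := f.map_inner' (α x) (α y)
    have h2 : ⟪f (α x), f (α y)⟫_(C₀(X, ℂ)) = ⟪α x, α y⟫_(C₀(X, ℂ)) := this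
    rw [hfα, hfα] at h2
    exact h2.symm
  have hact (a : C₀(X, ℂ)) (x : ellTwo U) : ((α (a • x) : openPart M U) : M) = a • (α x : M) := by
    have h1 : f (a • α x) = a • f (α x) := f.map_act' a (α x)
    rw [hfα] at h1
    rw [← h1, hαf]
    rfl
  have hnorm (x : ellTwo U) : ‖((α x : openPart M U) : M)‖ = ‖x‖ := by
    rw [CStarModule.norm_eq_sqrt_norm_inner_self (A := C₀(X, ℂ)), hα]
    rfl
  have hh' : star h ∈ openIdeal U := fun t ht => by
    rw [ZeroAtInftyContinuousMap.star_apply, hh t ht, star_zero]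
  have hg : star h * h ∈ openIdeal U := fun t ht => by
    rw [ZeroAtInftyContinuousMap.mul_apply, hh t ht, mul_zero]
  have hg' : h * star h ∈ openIdeal U := fun t ht => by
    rw [ZeroAtInftyContinuousMap.mul_apply, hh t ht, zero_mul]
  have hgs : star (star h * h) = star h * h := by
    ext t
    simp [mul_comm]
  refine ⟨fun k => (α (ellTwo.single k (star h * h) hg) : M), fun k => (α _).2, fun k => ?_,
    fun k l hkl => ?_, fun m => ?_, fun k => ?_, fun m => ?_⟩
  · rw [hα, ellTwo.inner_single_right]
    simp [ellTwo.single, hgs]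
  · rw [hα, ellTwo.inner_single_right]
    simp [ellTwo.single, hkl.symm]
  · obtain ⟨x, hx⟩ : ∃ x : ellTwo U, (α x : M) = h • m :=
      ⟨f ⟨h • m, act_mem_openPart hh m⟩, by rw [hαf]⟩
    have e (k : ℕ) : ⟪m, (α (ellTwo.single k (star h * h) hg) : M)⟫_(C₀(X, ℂ)) =
        star (x.1 k) * h := by
      rw [← ellTwo.act_single (star h) k hh, hact, CStarModule.inner_op_smul_right, mul_comm,
        ← CStarModule.inner_op_smul_left, ← hx, hα, ellTwo.inner_single_right]
    simp only [e]
    have h1 := ((continuous_star.tendsto (0 : C₀(X, ℂ))).comp (ellTwo.tendsto_coord x)).mul_const h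
    simpa using h1
  · refine ⟨(α (ellTwo.single k (star h) hh') : M), ?_⟩
    rw [← hact, ellTwo.act_single h k hh' hg']
    congr 3
    exact mul_comm _ _
  · obtain ⟨x, hx⟩ : ∃ x : ellTwo U, (α x : M) = (star h * h) • m :=
      ⟨f ⟨(star h * h) • m, act_mem_openPart hg m⟩, by rw [hαf]⟩
    have e (K : ℕ) : (star h * h) • ((α (∑ k ∈ Finset.range K,
        ellTwo.single k (x.1 k) (x.2.1 k)) : openPart M U) : M) =
        ∑ k ∈ Finset.range K, x.1 k • ((α (ellTwo.single k (star h * h) hg) : openPart M U) : M) := by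
      have hl (y : M) : (star h * h) • y = actₗ (star h * h) y := rfl
      rw [map_sum, Submodule.coe_sum, hl, map_sum]
      refine Finset.sum_congr rfl fun k _ => ?_
      rw [← hl, ← hact, ← hact, ellTwo.act_single (star h * h) k (x.2.1 k)
        (fun t ht => by simp [hh t ht]), ellTwo.act_single (x.1 k) k hg
        (fun t ht => by simp [hh t ht])]
      congr 3
      exact mul_comm _ _
    have hlim : Tendsto (fun K => ((α (∑ k ∈ Finset.range K,
        ellTwo.single k (x.1 k) (x.2.1 k)) : openPart M U) : M)) atTop (𝓝 (α x : M)) := by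
      rw [tendsto_iff_norm_sub_tendsto_zero]
      refine (ellTwo.tendsto_norm_sub_sum_single x).congr fun K => ?_
      rw [norm_sub_rev, ← Submodule.coe_sub, ← map_sub, hnorm]
    have hlim' := ((continuous_act (star h * h)).tendsto (α x : M)).comp hlim
    rw [mul_act, ← hx]
    refine (Submodule.isClosed_topologicalClosure _).mem_of_tendsto hlim'
      (Eventually.of_forall fun K => ?_)
    simp only [Function.comp_apply, e]
    exact Submodule.sum_mem _ fun k _ => Submodule.le_topologicalClosure _
      (Submodule.subset_span ⟨_, k, rfl⟩)

theorem IsFrame.norm_le {U : Opens X} {h : C₀(X, ℂ)} {e : ℕ → M} (he : IsFrame U h e) (k : ℕ) :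
    ‖e k‖ ≤ √‖star h * h * (star h * h)‖ := by
  rw [CStarModule.norm_eq_sqrt_norm_inner_self (A := C₀(X, ℂ)), he.inner_self]

end Frame

/-! ### An operator with dense range -/

section DenseRange

variable {X : Type*} [TopologicalSpace X] [LocallyCompactSpace X] [T2Space X]
variable {M : Type*} [NormedAddCommGroup M] [NormedSpace ℂ M] [SMul C₀(X, ℂ) M]
  [CStarModule C₀(X, ℂ) M] [CompleteSpace M]
variable {N : Type*} [NormedAddCommGroup N] [NormedSpace ℂ N] [SMul C₀(X, ℂ) N]
  [CStarModule C₀(X, ℂ) N] [CompleteSpace N]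

theorem mem_closure_range_nuc {n : ℕ → N} (h : Summable fun i => ‖n i‖ * ‖n i‖) (j : ℕ) :
    n j ∈ closure (Set.range (nuc X n n)) := by
  set P := nuc X n n with hP
  have hr : 0 < 1 + ‖P‖ := by positivity
  have hc : (((1 + ‖P‖)⁻¹ : ℝ) : ℂ) ≠ 0 := Complex.ofReal_ne_zero.2 (inv_pos.2 hr).ne'
  have h1 := ((isPos_nuc (X := X) h).smul_ofReal (inv_pos.2 hr).le).mem_closure_range
    (norm_ofReal_smul_le_one hr (by linarith)) (y := n j) hr.le fun x t => by
      rw [smul_apply, CStarModule.inner_smul_right_complex, ZeroAtInftyContinuousMap.smul_apply,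
        smul_eq_mul, norm_mul, Complex.norm_real, Real.norm_of_nonneg (inv_pos.2 hr).le,
        mul_inv_cancel_left₀ hr.ne']
      exact norm_inner_sq_le_nuc h j x t
  refine closure_mono ?_ h1
  rintro _ ⟨x, rfl⟩
  exact ⟨(((1 + ‖P‖)⁻¹ : ℝ) : ℂ) • x, by rw [map_smul, smul_apply]⟩

/-- The weights `2^{-j²}`. -/
def weight (j : ℕ) : ℝ := (1 / 2) ^ j ^ 2

theorem weight_pos (j : ℕ) : 0 < weight j := by
  unfold weight
  positivity

theorem weight_le (j : ℕ) : weight j ≤ (1 / 2) ^ j :=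
  pow_le_pow_of_le_one (by norm_num) (by norm_num) (Nat.le_self_pow two_ne_zero j)

theorem weight_le_of_lt {i j : ℕ} (h : j < i) :
    weight i ≤ weight j * (1 / 2) ^ j * (1 / 2) ^ i := by
  unfold weight
  rw [← pow_add, ← pow_add]
  refine pow_le_pow_of_le_one (by norm_num) (by norm_num) ?_
  nlinarith

theorem summable_weight {f : ℕ → N} {e : ℕ → M} {C D : ℝ} (hf : ∀ k, ‖f k‖ ≤ C)
    (he : ∀ k, ‖e k‖ ≤ D) (a b : ℕ → ℕ) :
    Summable fun j => ‖e (a j)‖ * ‖(weight j : ℂ) • f (b j)‖ := by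
  have hD : 0 ≤ D := (norm_nonneg _).trans (he 0)
  refine Summable.of_nonneg_of_le (fun j => by positivity) (fun j => ?_)
    (summable_geometric_two.mul_right (D * C))
  rw [norm_smul, Complex.norm_real, Real.norm_of_nonneg (weight_pos j).le]
  calc ‖e (a j)‖ * (weight j * ‖f (b j)‖) ≤ D * ((1 / 2) ^ j * C) := by
        have := weight_pos j
        gcongr
        · exact he _
        · exact weight_le j
        · exact hf _
    _ = (1 / 2) ^ j * (D * C) := by ring

variable {U : Opens X} {h : C₀(X, ℂ)} {e : ℕ → M} {f : ℕ → N}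

theorem IsFrame.norm_nuc_sub_le (he : IsFrame U h e) (hf : IsFrame U h f) {a : ℕ → ℕ} (b : ℕ → ℕ)
    {j : ℕ} (ha : ∀ i < j, a i ≠ a j) :
    ‖nuc X (fun i => (weight i : ℂ) • f (b i)) (fun i => e (a i)) (e (a j)) -
      (weight j : ℂ) • (star h * h * (star h * h)) • f (b j)‖ ≤
      weight j * (1 / 2) ^ j *
        (2 * (‖star h * h * (star h * h)‖ * √‖star h * h * (star h * h)‖)) := by
  set G := star h * h * (star h * h) with hG
  have hs := hasSum_nuc (X := X) (summable_weight hf.norm_le he.norm_le a b) (e (a j))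
  have hsub := hs.sub (hasSum_ite_eq j ((weight j : ℂ) • G • f (b j)))
  rw [← hsub.tsum_eq]
  have hbound (i : ℕ) : ‖⟪e (a i), e (a j)⟫_(C₀(X, ℂ)) • ((weight i : ℂ) • f (b i)) -
      (if i = j then (weight j : ℂ) • G • f (b j) else 0)‖ ≤
      (1 / 2) ^ i * (weight j * (1 / 2) ^ j * (‖G‖ * √‖G‖)) := by
    have hw := (weight_pos j).le
    rcases lt_trichotomy i j with hij | rfl | hij
    · rw [if_neg hij.ne, he.inner_of_ne _ _ (ha i hij), sub_zero]
      have h0 : (0 : C₀(X, ℂ)) • ((weight i : ℂ) • f (b i)) = 0 := by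
        rw [← sub_self (0 : C₀(X, ℂ)), sub_act, sub_self]
      rw [h0, norm_zero]
      positivity
    · rw [if_pos rfl, he.inner_self, act_smul, sub_self, norm_zero]
      positivity
    · rw [if_neg hij.ne', sub_zero, act_smul, norm_smul, Complex.norm_real,
        Real.norm_of_nonneg (weight_pos i).le]
      have h1 : ‖⟪e (a i), e (a j)⟫_(C₀(X, ℂ)) • f (b i)‖ ≤ ‖G‖ * √‖G‖ := by
        refine (norm_act_le _ _).trans (mul_le_mul ?_ (hf.norm_le _) (norm_nonneg _)
          (norm_nonneg _))
        by_cases hk : a i = a j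
        · rw [hk, he.inner_self]
        · rw [he.inner_of_ne _ _ hk, norm_zero]
          exact norm_nonneg _
      calc weight i * ‖⟪e (a i), e (a j)⟫_(C₀(X, ℂ)) • f (b i)‖
          ≤ (weight j * (1 / 2) ^ j * (1 / 2) ^ i) * (‖G‖ * √‖G‖) := by
            gcongr
            exact weight_le_of_lt hij
        _ = _ := by ring
  refine (tsum_of_norm_bounded (hasSum_geometric_two.mul_right _) hbound).trans (le_of_eq ?_)
  ring

/-- The key construction: `T₀ + J` has dense range if `J` maps sufficiently many vectors of an
orthogonal sequence, on which `T₀` is negligible, to multiples of the members of such a sequence. -/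
theorem IsFrame.denseRange_nuc_add (he : IsFrame U h e) (hf : IsFrame U h f)
    {m : ℕ → M} {n : ℕ → N} (hmn : Summable fun i => ‖m i‖ * ‖n i‖)
    (hnn : Summable fun i => ‖n i‖ * ‖n i‖)
    (hn : Dense (Submodule.span ℂ {x : N | ∃ (a : C₀(X, ℂ)) (i : ℕ), x = a • n i} : Set N))
    (hd : ∀ i j t, h t = 0 → (⟪n i, n j⟫_(C₀(X, ℂ)) - ⟪m i, m j⟫_(C₀(X, ℂ))) t = 0)
    {a b : ℕ → ℕ} (hab : ∀ s J, ∃ j ≥ J, b j = s ∧ (∀ i < j, a i ≠ a j) ∧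
      ‖nuc X n m (e (a j))‖ ≤ weight j * (1 / 2) ^ j) :
    DenseRange (nuc X n m + nuc X (fun i => (weight i : ℂ) • f (b i)) (fun i => e (a i))) := by
  set G := star h * h * (star h * h) with hG
  set J := nuc X (fun i => (weight i : ℂ) • f (b i)) (fun i => e (a i)) with hJ
  set T := nuc X n m + J with hT
  have hsJ := summable_weight hf.norm_le he.norm_le a b
  have hJs := hasSum_nuc (X := X) hsJ
  have hTa (c : C₀(X, ℂ)) (x : M) : T (c • x) = c • T x := by
    rw [hT, add_apply, add_apply, act_add, map_act_of_adjoint (inner_nuc hmn),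
      map_act_of_adjoint (inner_nuc hsJ)]
  let R : Submodule ℂ N := (LinearMap.range (T : M →ₗ[ℂ] N)).topologicalClosure
  have hRc : IsClosed (R : Set N) := Submodule.isClosed_topologicalClosure _
  have hTR (x : M) : T x ∈ R := Submodule.le_topologicalClosure _ ⟨x, rfl⟩
  have hRa (c : C₀(X, ℂ)) {y : N} (hy : y ∈ R) : c • y ∈ R := by
    have hcl : IsClosed {y : N | c • y ∈ R} := hRc.preimage (continuous_act c)
    refine closure_minimal (fun y hy => ?_) hcl hy
    obtain ⟨x, rfl⟩ := hy
    change c • T x ∈ R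
    rw [← hTa]
    exact hTR _
  have hspan {z : ℕ → N} (hz : ∀ (c : C₀(X, ℂ)) k, c • z k ∈ R) {y : N}
      (hy : y ∈ Submodule.span ℂ {x : N | ∃ (a : C₀(X, ℂ)) (k : ℕ), x = a • z k}) : y ∈ R := by
    refine Submodule.span_le.2 ?_ hy
    rintro _ ⟨c, k, rfl⟩
    exact hz c k
  have h1 (s : ℕ) : G • f s ∈ R := by
    refine hRc.closure_subset_iff.2 (subset_refl _) ?_
    rw [Metric.mem_closure_iff]
    intro ε hε
    set C := 1 + 2 * (‖G‖ * √‖G‖) with hC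
    have hC0 : 0 < C := by positivity
    obtain ⟨j0, hj0⟩ := exists_pow_lt_of_lt_one (div_pos hε hC0) (by norm_num : (1 / 2 : ℝ) < 1)
    obtain ⟨j, hj, rfl, hfresh, hsmall⟩ := hab s j0
    have hw := weight_pos j
    have hwC : (weight j : ℂ) ≠ 0 := Complex.ofReal_ne_zero.2 hw.ne'
    refine ⟨(weight j : ℂ)⁻¹ • T (e (a j)), R.smul_mem _ (hTR _), ?_⟩
    rw [dist_comm, dist_eq_norm]
    have e1 : (weight j : ℂ)⁻¹ • T (e (a j)) - G • f (b j) = (weight j : ℂ)⁻¹ •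
        (nuc X n m (e (a j)) + (J (e (a j)) - (weight j : ℂ) • G • f (b j))) := by
      rw [hT, add_apply, smul_add, smul_add, smul_sub, inv_smul_smul₀ hwC, add_sub_assoc]
    rw [e1, norm_smul, norm_inv, Complex.norm_real, Real.norm_of_nonneg hw.le,
      inv_mul_lt_iff₀ hw]
    have h2 := he.norm_nuc_sub_le hf b hfresh
    calc _ ≤ weight j * (1 / 2) ^ j + weight j * (1 / 2) ^ j * (2 * (‖G‖ * √‖G‖)) :=
          (norm_add_le _ _).trans (add_le_add hsmall h2)
      _ = weight j * ((1 / 2) ^ j * C) := by ring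
      _ ≤ weight j * ((1 / 2) ^ j0 * C) := by
          gcongr ?_ * (?_ * _)
          exact pow_le_pow_of_le_one (by norm_num) (by norm_num) hj
      _ < weight j * ε := by
          gcongr
          rwa [lt_div_iff₀ hC0] at hj0
  have h2 (y : N) : G • G • y ∈ R := by
    have hcl : IsClosed {y : N | G • y ∈ R} := hRc.preimage (continuous_act G)
    refine closure_minimal (fun y hy => ?_) hcl (hf.mem_closure y)
    have hle : Submodule.span ℂ {n : N | ∃ (a : C₀(X, ℂ)) (k : ℕ), n = a • f k} ≤
        R.comap (actₗ G) := by
      refine Submodule.span_le.2 ?_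
      rintro _ ⟨c, k, rfl⟩
      change G • c • f k ∈ R
      rw [act_comm]
      exact hRa c (h1 k)
    exact hle hy
  have h3 {d : C₀(X, ℂ)} (hd : ∀ t, h t = 0 → d t = 0) (y : N) : d • y ∈ R := by
    have hcl : IsClosed {d : C₀(X, ℂ) | d • y ∈ R} := hRc.preimage (continuous_act_left y)
    have hmem : d ∈ closure (Set.range fun a : C₀(X, ℂ) => a * (G * G)) :=
      mem_closure_range_mul fun t ht => hd t (by simpa [hG] using ht)
    refine closure_minimal ?_ hcl hmem
    rintro _ ⟨c, rfl⟩
    change (c * (G * G)) • y ∈ R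
    rw [mul_act, mul_act]
    exact hRa c (h2 y)
  have h4 (k : ℕ) : f k ∈ R := by
    obtain ⟨u, hu⟩ := hf.eq_act k
    rw [hu]
    exact h3 (fun _ => id) u
  have h5 (x : M) : nuc X n m x ∈ R := by
    have hJx : J x ∈ R := hasSum_mem hRc (hJs x) fun i => hRa _ (R.smul_mem _ (h4 _))
    have : nuc X n m x = T x - J x := by rw [hT, add_apply, add_sub_cancel_right]
    rw [this]
    exact R.sub_mem (hTR x) hJx
  have h6 (j : ℕ) : nuc X n n (n j) ∈ R := by
    have hsub := (hasSum_nuc (X := X) hnn (n j)).sub (hasSum_nuc (X := X) hmn (m j))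
    have : nuc X n n (n j) - nuc X n m (m j) ∈ R := hasSum_mem hRc hsub fun i => by
      rw [← sub_act]
      exact h3 (hd i j) _
    simpa using R.add_mem this (h5 (m j))
  have h7 (y : N) : nuc X n n y ∈ R := by
    have hcl : IsClosed {y : N | nuc X n n y ∈ R} := hRc.preimage (nuc X n n).continuous
    refine closure_minimal (fun y hy => ?_) hcl (hn y)
    have hle : Submodule.span ℂ {x : N | ∃ (a : C₀(X, ℂ)) (i : ℕ), x = a • n i} ≤
        R.comap (nuc X n n : N →ₗ[ℂ] N) := by
      refine Submodule.span_le.2 ?_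
      rintro _ ⟨c, k, rfl⟩
      change nuc X n n (c • n k) ∈ R
      rw [map_act_of_adjoint (inner_nuc hnn)]
      exact hRa c (h6 k)
    exact hle hy
  have h8 (j : ℕ) : n j ∈ R := by
    refine closure_minimal ?_ hRc (mem_closure_range_nuc (X := X) hnn j)
    rintro _ ⟨y, rfl⟩
    exact h7 y
  intro y
  exact closure_minimal (fun y hy => hspan (fun c k => hRa c (h8 k)) hy) hRc (hn y)

end DenseRange

/-! ### Extension of isomorphisms -/

section Extension

variable {X : Type*} [TopologicalSpace X] [LocallyCompactSpace X] [T2Space X]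
variable {M : Type*} [NormedAddCommGroup M] [NormedSpace ℂ M] [SMul C₀(X, ℂ) M]
  [CStarModule C₀(X, ℂ) M]
variable {N : Type*} [NormedAddCommGroup N] [NormedSpace ℂ N] [SMul C₀(X, ℂ) N]
  [CStarModule C₀(X, ℂ) N]

theorem CountablyGenerated.exists_seq (hM : CountablyGenerated C₀(X, ℂ) M) :
    ∃ p : ℕ → M, Dense (Submodule.span ℂ {x : M | ∃ (a : C₀(X, ℂ)) (i : ℕ), x = a • p i} : Set M) := by
  obtain ⟨s, hs, hd⟩ := hM
  obtain ⟨p, hp⟩ := (hs.insert 0).exists_eq_range (Set.insert_nonempty _ _)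
  refine ⟨p, hd.mono (Submodule.span_mono ?_)⟩
  rintro _ ⟨a, m, hm, rfl⟩
  obtain ⟨i, rfl⟩ : m ∈ Set.range p := hp ▸ Set.mem_insert_of_mem 0 hm
  exact ⟨a, i, rfl⟩

theorem dense_span_of_smul {ι : Type*} {p : ℕ → M} {q : ι → M} {r : ℕ → ι} {c : ι → ℂ}
    (hc : ∀ i, c i ≠ 0) (hq : ∀ i, q (r i) = p i)
    (hp : Dense (Submodule.span ℂ {x : M | ∃ (a : C₀(X, ℂ)) (i : ℕ), x = a • p i} : Set M)) :
    Dense (Submodule.span ℂ {x : M | ∃ (a : C₀(X, ℂ)) (i : ι), x = a • (c i • q i)} : Set M) := by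
  refine hp.mono (Submodule.span_mono ?_)
  rintro _ ⟨a, i, rfl⟩
  refine ⟨(c (r i))⁻¹ • a, r i, ?_⟩
  rw [act_smul, smul_act, smul_inv_smul₀ (hc _), hq]

/-- Generators of `M` and `N` that correspond to each other under `φ`. -/
theorem exists_generators {U : Opens X}
    (φ : Iso C₀(Compl U, ℂ) (closedPart M U) (closedPart N U))
    (hM : CountablyGenerated C₀(X, ℂ) M) (hN : CountablyGenerated C₀(X, ℂ) N) :
    ∃ (m : ℕ → M) (n : ℕ → N), (∀ i, ‖m i‖ ≤ (1 / 2) ^ i) ∧ (∀ i, ‖n i‖ ≤ (1 / 2) ^ i) ∧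
      (∀ i, φ (toClosed U (m i)) = toClosed U (n i)) ∧
      Dense (Submodule.span ℂ {x : M | ∃ (a : C₀(X, ℂ)) (i : ℕ), x = a • m i} : Set M) ∧
      Dense (Submodule.span ℂ {x : N | ∃ (a : C₀(X, ℂ)) (i : ℕ), x = a • n i} : Set N) := by
  obtain ⟨p, hp⟩ := hM.exists_seq
  obtain ⟨q, hq⟩ := hN.exists_seq
  choose p' hp' using fun i => toClosed_surjective U (φ (toClosed U (p i)))
  choose q' hq' using fun i => toClosed_surjective U (φ.toLinearEquiv.symm (toClosed U (q i)))
  let E : ℕ ≃ ℕ ⊕ ℕ := Equiv.natSumNatEquivNat.symm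
  let m : ℕ → M := fun i => Sum.elim p q' (E i)
  let n : ℕ → N := fun i => Sum.elim p' q (E i)
  let c : ℕ → ℝ := fun i => (1 / 2) ^ i / (1 + ‖m i‖ + ‖n i‖)
  have hc (i : ℕ) : 0 < c i := by positivity
  have hcC (i : ℕ) : (c i : ℂ) ≠ 0 := Complex.ofReal_ne_zero.2 (hc i).ne'
  have hmn (i : ℕ) : φ (toClosed U (m i)) = toClosed U (n i) := by
    simp only [m, n]
    rcases E i with k | k
    · exact (hp' k).symm
    · simp only [Sum.elim_inr]
      rw [hq', LinearEquiv.apply_symm_apply]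
  refine ⟨fun i => (c i : ℂ) • m i, fun i => (c i : ℂ) • n i, fun i => ?_, fun i => ?_,
    fun i => ?_, ?_, ?_⟩
  · rw [norm_smul, Complex.norm_real, Real.norm_of_nonneg (hc i).le, div_mul_eq_mul_div,
      div_le_iff₀ (by positivity)]
    gcongr
    linarith [norm_nonneg (n i)]
  · rw [norm_smul, Complex.norm_real, Real.norm_of_nonneg (hc i).le, div_mul_eq_mul_div,
      div_le_iff₀ (by positivity)]
    gcongr
    linarith [norm_nonneg (m i)]
  · rw [map_smul, map_smul, map_smul, hmn]
  · exact dense_span_of_smul (r := fun i => E.symm (Sum.inl i)) hcC (fun i => by simp [m]) hp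
  · exact dense_span_of_smul (r := fun i => E.symm (Sum.inr i)) hcC (fun i => by simp [n]) hq

theorem exists_alternating_indices {κ : ℕ → ℕ} (hκ : StrictMono κ) :
    ∃ a b : ℕ → ℕ,
      (∀ s J, ∃ j ≥ J, b j = s ∧ (∀ i < j, a i ≠ a j) ∧ a j = κ j) ∧
      (∀ s J, ∃ j ≥ J, a j = s ∧ (∀ i < j, b i ≠ b j) ∧ b j = κ j) := by
  let s : ℕ → ℕ := fun j => (Nat.unpair (j / 2)).1
  have hs (j : ℕ) : s j ≤ j := (Nat.unpair_left_le _).trans (Nat.div_le_self _ _)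
  have hfresh {i j : ℕ} (hij : i < j) : s i ≠ κ j := by
    have := hκ.id_le j
    have := hs i
    simp only [id] at *
    omega
  refine ⟨fun j => if Even j then κ j else s j, fun j => if Even j then s j else κ j,
    fun u J => ⟨2 * Nat.pair u J, ?_, ?_, fun i hi => ?_, ?_⟩,
    fun u J => ⟨2 * Nat.pair u J + 1, ?_, ?_, fun i hi => ?_, ?_⟩⟩
  · have := Nat.right_le_pair u J
    omega
  · simp [s]
  · beta_reduce
    rw [if_pos (even_two_mul (Nat.pair u J))]
    split_ifs
    · exact (hκ hi).ne
    · exact hfresh hi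
  · beta_reduce
    rw [if_pos (even_two_mul (Nat.pair u J))]
  · have := Nat.right_le_pair u J
    omega
  · have : (2 * Nat.pair u J + 1) / 2 = Nat.pair u J := by omega
    simp [s, this]
  · beta_reduce
    rw [if_neg (Nat.not_even_two_mul_add_one (Nat.pair u J))]
    split_ifs
    · exact hfresh hi
    · exact (hκ hi).ne
  · beta_reduce
    rw [if_neg (Nat.not_even_two_mul_add_one (Nat.pair u J))]

end Extension

end HilbertC0

end

theorem mainTheorem12 {X : Type*} [TopologicalSpace X] [LocallyCompactSpace X] [T2Space X]
    (U : Opens X)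
    {M : Type*} [NormedAddCommGroup M] [NormedSpace ℂ M] [SMul C₀(X, ℂ) M]
    [CStarModule C₀(X, ℂ) M] [CompleteSpace M]
    {N : Type*} [NormedAddCommGroup N] [NormedSpace ℂ N] [SMul C₀(X, ℂ) N]
    [CStarModule C₀(X, ℂ) N] [CompleteSpace N]
    (hM : HilbertC0.CountablyGenerated C₀(X, ℂ) M)
    (hN : HilbertC0.CountablyGenerated C₀(X, ℂ) N)
    (hMU : Nonempty (HilbertC0.Iso C₀(X, ℂ) (HilbertC0.openPart M U) (HilbertC0.ellTwo U)))
    (hNU : Nonempty (HilbertC0.Iso C₀(X, ℂ) (HilbertC0.openPart N U) (HilbertC0.ellTwo U)))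
    (φ : HilbertC0.Iso C₀(HilbertC0.Compl U, ℂ)
      (HilbertC0.closedPart M U) (HilbertC0.closedPart N U)) :
    ∃ ψ : HilbertC0.Iso C₀(X, ℂ) M N,
      ∀ m : M, HilbertC0.toClosed U (ψ m) = φ (HilbertC0.toClosed U m) := by
  open HilbertC0 in
  obtain ⟨m, n, hm, hn, hφ, hmd, hnd⟩ := exists_generators φ hM hN
  have hsum {u v : ℕ → ℝ} (hu : ∀ i, u i ≤ (1 / 2) ^ i) (hv : ∀ i, v i ≤ (1 / 2) ^ i)
      (hu0 : ∀ i, 0 ≤ u i) (hv0 : ∀ i, 0 ≤ v i) : Summable fun i => u i * v i :=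
    Summable.of_nonneg_of_le (fun i => mul_nonneg (hu0 i) (hv0 i)) (fun i =>
      (mul_le_mul (hu i) ((hv i).trans (pow_le_one₀ (by norm_num) (by norm_num))) (hv0 i)
        (by positivity)).trans (mul_one _).le) summable_geometric_two
  have hmn := hsum hm hn (fun _ => norm_nonneg _) fun _ => norm_nonneg _
  have hnm := hsum hn hm (fun _ => norm_nonneg _) fun _ => norm_nonneg _
  have hmm := hsum hm hm (fun _ => norm_nonneg _) fun _ => norm_nonneg _
  have hnn := hsum hn hn (fun _ => norm_nonneg _) fun _ => norm_nonneg _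
  have hdU (i j : ℕ) : ⟪n i, n j⟫_(C₀(X, ℂ)) - ⟪m i, m j⟫_(C₀(X, ℂ)) ∈ openIdeal U := fun t ht => by
    have h1 : res U ⟪n i, n j⟫_(C₀(X, ℂ)) = res U ⟪m i, m j⟫_(C₀(X, ℂ)) := by
      rw [← inner_toClosed, ← inner_toClosed, ← hφ, ← hφ]
      exact φ.map_inner' _ _
    have h2 := DFunLike.congr_fun h1 ⟨t, ht⟩
    simpa [sub_eq_zero] using h2
  obtain ⟨h, hhU, hh⟩ := exists_mem_openIdeal (U := U)
    (d := fun k => ⟪n k.unpair.1, n k.unpair.2⟫_(C₀(X, ℂ)) -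
      ⟪m k.unpair.1, m k.unpair.2⟫_(C₀(X, ℂ))) fun k => hdU _ _
  have hd (i j : ℕ) (t : X) (ht : h t = 0) :
      (⟪n i, n j⟫_(C₀(X, ℂ)) - ⟪m i, m j⟫_(C₀(X, ℂ))) t = 0 := by
    simpa using hh t ht (Nat.pair i j)
  have hd' (i j : ℕ) (t : X) (ht : h t = 0) :
      (⟪m i, m j⟫_(C₀(X, ℂ)) - ⟪n i, n j⟫_(C₀(X, ℂ))) t = 0 := by
    rw [← neg_sub, ZeroAtInftyContinuousMap.neg_apply, hd i j t ht, neg_zero]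
  obtain ⟨e, he⟩ := exists_isFrame hhU hMU.some
  obtain ⟨f, hf⟩ := exists_isFrame hhU hNU.some
  obtain ⟨κ, hκ, hκs⟩ := extraction_forall_of_eventually (P := fun j k =>
      ‖nuc X n m (e k)‖ ≤ weight j * (1 / 2) ^ j ∧ ‖nuc X m n (f k)‖ ≤ weight j * (1 / 2) ^ j)
    fun j => by
      have hpos : 0 < weight j * (1 / 2) ^ j := mul_pos (weight_pos j) (by positivity)
      have h1 := (tendsto_nuc_zero hmn he.norm_le he.tendsto).norm
      have h2 := (tendsto_nuc_zero hnm hf.norm_le hf.tendsto).norm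
      rw [norm_zero] at h1 h2
      exact (h1.eventually_le_const hpos).and (h2.eventually_le_const hpos)
  obtain ⟨a, b, hab, hba⟩ := exists_alternating_indices hκ
  have hsJ := summable_weight hf.norm_le he.norm_le a b
  have hsJ' := summable_weight he.norm_le hf.norm_le b a
  have hT := he.denseRange_nuc_add hf hmn hnn hnd hd (a := a) (b := b) fun s J => by
    obtain ⟨j, hj, h1, h2, h3⟩ := hab s J
    exact ⟨j, hj, h1, h2, h3 ▸ (hκs j).1⟩
  have hT' := hf.denseRange_nuc_add he hnm hmm hmd hd' (a := b) (b := a) fun s J => by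
    obtain ⟨j, hj, h1, h2, h3⟩ := hba s J
    exact ⟨j, hj, h1, h2, h3 ▸ (hκs j).2⟩
  set J := nuc X (fun i => (weight i : ℂ) • f (b i)) (fun i => e (a i)) with hJ
  set J' := nuc X (fun i => (weight i : ℂ) • e (a i)) (fun i => f (b i)) with hJ'
  have hJadj (x : M) (y : N) : ⟪J x, y⟫_(C₀(X, ℂ)) = ⟪x, J' y⟫_(C₀(X, ℂ)) := by
    rw [hJ, inner_nuc hsJ, nuc_smul_comm]
  have hadj (x : M) (y : N) :
      ⟪(nuc X n m + J) x, y⟫_(C₀(X, ℂ)) = ⟪x, (nuc X m n + J') y⟫_(C₀(X, ℂ)) := by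
    rw [add_apply, add_apply, CStarModule.inner_add_left, CStarModule.inner_add_right,
      inner_nuc hmn, hJadj]
  have hJU (x : M) : toClosed U (J x) = 0 := toClosed_eq_zero.2
    (nuc_mem_openPart hsJ (fun i => Submodule.smul_mem _ _ (hf.mem _)) x)
  have hJU' (y : N) : toClosed U (J' y) = 0 := toClosed_eq_zero.2
    (nuc_mem_openPart hsJ' (fun i => Submodule.smul_mem _ _ (he.mem _)) y)
  have hTφ (x : M) : toClosed U ((nuc X n m + J) x) = φ (toClosed U (nuc X m m x)) := by
    rw [add_apply, map_add, hJU, add_zero, toClosed_nuc φ hφ hmn hmm]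
  refine exists_iso_of_adjoint φ hadj (isPos_nuc hmm) hT hT' (fun x => ?_) hTφ
  rw [← toClosed_eq_zero, map_sub, sub_eq_zero, add_apply, map_add, hJU', add_zero]
  exact toClosed_nuc_adjoint φ hφ hnm hmm (hTφ x)
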